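/- **Setting.** A groupoid $G$ is regarded as a set with a partial product, $\mathbf d(g)=g^{-1}g$, $\mathbf r(g)=gg^{-1}$, and $G_o$ is its set of identities. A *Boolean groupoid* is a topological groupoid (not necessarily Hausdorff) that is étale ($\mathbf d\colon G\to G$ is a local homeomorphism) and whose identity space $G_o$ is Hausdorff, locally compact and has a base of clopen sets. For subsets, $AB$ is the set of all defined products $ab$ with $a\in A$, $b\in B$, and $A^{-1}$ the set of inverses; $A$ is a *local bisection* if $A^{-1}A,\,AA^{-1}\subseteq G_o$, and a *bisection* if $A^{-1}A=AA^{-1}=G_o$. $\mathsf{KB}(G)$ is the Boolean inverse semigroup of all compact-open local bisections of $G$ under subset multiplication. When $G_o$ is compact, the *topological full group* of $G$ is the group of all compact-open bisections of $G$ under subset multiplication. $G^\infty=G\cup\{\infty\}$ is the groupoid obtained from $G$ by adjoining a new identity $\infty$, with the topology that has as a base the open subsets of $G$ together with the open subsets of the one-point compactification $G_o\cup\{\infty\}$ of $G_o$; it is a Boolean groupoid with compact identity space. Let $S$ be a Boolean inverse semigroup with idempotents $\mathsf E(S)$. For $e\in\mathsf E(S)$ let $G_e$ be the group of units of the monoid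 $eSe$, and for $e\le f$ let $\phi^e_f\colon G_e\to G_f$ be the homomorphism $a\mapsto a\vee(f\setminus e)$. Let $\mathsf C(S)$ be the disjoint union of the groups $G_e$ with the product $a\circ b=\phi^e_{e\vee f}(a)\,\phi^f_{e\vee f}(b)$ for $a\in G_e$, $b\in G_f$; it is an inverse semigroup with central idempotents. The *group of units* of $S$ is $\mathsf U(S)=\mathsf C(S)/\sigma$, where $\sigma$ is the least congruence on $\mathsf C(S)$ whose quotient is a group. **Proposition.** Let $G$ be a Boolean groupoid and put $S=\mathsf{KB}(G)$. Then the group of units $\mathsf U(S)$ is isomorphic to the topological full group of $G^\infty$. Moreover, the group of units $\mathsf U(\mathsf{KB}(G^\infty))$ is also isomorphic to the topological full group of $G^\infty$. -/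

import Mathlib

/-! ### Inverse semigroups and Boolean inverse semigroups -/

namespace BISG

universe u

/-- An inverse semigroup: a regular semigroup whose idempotents commute, with its inversion. -/
class InverseSemigroup (S : Type u) extends Semigroup S, Inv S where
  mul_inv_mul : ∀ a : S, a * a⁻¹ * a = a
  inv_mul_inv : ∀ a : S, a⁻¹ * a * a⁻¹ = a⁻¹
  idem_comm : ∀ e f : S, IsIdempotentElem e → IsIdempotentElem f → e * f = f * e

section InverseSemigroup

variable {S : Type u} [InverseSemigroup S]

theorem idem_mul_inv (a : S) : IsIdempotentElem (a * a⁻¹) := by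
  unfold IsIdempotentElem
  rw [← mul_assoc, InverseSemigroup.mul_inv_mul]

theorem idem_inv_mul (a : S) : IsIdempotentElem (a⁻¹ * a) := by
  unfold IsIdempotentElem
  rw [← mul_assoc, InverseSemigroup.inv_mul_inv]

theorem idem_mul {e f : S} (he : IsIdempotentElem e) (hf : IsIdempotentElem f) :
    IsIdempotentElem (e * f) := by
  have h := InverseSemigroup.idem_comm e f he hf
  unfold IsIdempotentElem at *
  calc e * f * (e * f) = e * (f * e) * f := by simp only [mul_assoc]
    _ = e * e * (f * f) := by rw [← h]; simp only [mul_assoc]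
    _ = e * f := by rw [he, hf]

theorem inv_unique {a x : S} (h1 : a * x * a = a) (h2 : x * a * x = x) : x = a⁻¹ := by
  have i1 : IsIdempotentElem (a * x) := by
    unfold IsIdempotentElem; rw [← mul_assoc, h1]
  have i2 : IsIdempotentElem (x * a) := by
    unfold IsIdempotentElem; rw [← mul_assoc, h2]
  have e1 := InverseSemigroup.idem_comm _ _ i1 (idem_mul_inv a)
  have e2 := InverseSemigroup.idem_comm _ _ i2 (idem_inv_mul a)
  have f1 : a * x = a * a⁻¹ := by
    calc a * x = (a * a⁻¹ * a) * x := by rw [InverseSemigroup.mul_inv_mul]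
      _ = a * a⁻¹ * (a * x) := by simp only [mul_assoc]
      _ = a * x * (a * a⁻¹) := e1.symm
      _ = a * x * a * a⁻¹ := by simp only [mul_assoc]
      _ = a * a⁻¹ := by rw [h1]
  have f2 : x * a = a⁻¹ * a := by
    calc x * a = x * (a * a⁻¹ * a) := by rw [InverseSemigroup.mul_inv_mul]
      _ = x * a * (a⁻¹ * a) := by simp only [mul_assoc]
      _ = a⁻¹ * a * (x * a) := e2
      _ = a⁻¹ * (a * x * a) := by simp only [mul_assoc]
      _ = a⁻¹ * a := by rw [h1]
  calc x = x * a * x := h2.symm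
    _ = a⁻¹ * (a * x) := by rw [f2, mul_assoc]
    _ = a⁻¹ := by rw [f1, ← mul_assoc, InverseSemigroup.inv_mul_inv]

theorem inv_idem {e : S} (he : IsIdempotentElem e) : e⁻¹ = e := by
  unfold IsIdempotentElem at he
  exact (inv_unique (by rw [he, he]) (by rw [he, he])).symm

theorem inv_inv' (a : S) : a⁻¹⁻¹ = a :=
  (inv_unique (InverseSemigroup.inv_mul_inv a) (InverseSemigroup.mul_inv_mul a)).symm

theorem mul_inv_rev' (a b : S) : (a * b)⁻¹ = b⁻¹ * a⁻¹ := by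
  have h := InverseSemigroup.idem_comm _ _ (idem_mul_inv b) (idem_inv_mul a)
  symm
  apply inv_unique
  · calc a * b * (b⁻¹ * a⁻¹) * (a * b) = a * (b * b⁻¹ * (a⁻¹ * a)) * b := by
          simp only [mul_assoc]
      _ = (a * a⁻¹ * a) * (b * b⁻¹ * b) := by rw [h]; simp only [mul_assoc]
      _ = a * b := by rw [InverseSemigroup.mul_inv_mul, InverseSemigroup.mul_inv_mul]
  · calc b⁻¹ * a⁻¹ * (a * b) * (b⁻¹ * a⁻¹) = b⁻¹ * ((a⁻¹ * a) * (b * b⁻¹)) * a⁻¹ := by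
          simp only [mul_assoc]
      _ = (b⁻¹ * b * b⁻¹) * (a⁻¹ * a * a⁻¹) := by rw [← h]; simp only [mul_assoc]
      _ = b⁻¹ * a⁻¹ := by rw [InverseSemigroup.inv_mul_inv, InverseSemigroup.inv_mul_inv]

theorem idem_conj (a : S) {e : S} (he : IsIdempotentElem e) :
    IsIdempotentElem (a * e * a⁻¹) := by
  have h := InverseSemigroup.idem_comm _ _ he (idem_inv_mul a)
  unfold IsIdempotentElem at *
  calc a * e * a⁻¹ * (a * e * a⁻¹) = a * (e * (a⁻¹ * a)) * (e * a⁻¹) := by simp only [mul_assoc]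
    _ = (a * a⁻¹ * a) * (e * e) * a⁻¹ := by rw [h]; simp only [mul_assoc]
    _ = a * e * a⁻¹ := by rw [he, InverseSemigroup.mul_inv_mul]

/-- The natural partial order: `a ≤ b` iff `a = e * b` for some idempotent `e`. -/
instance natOrder : PartialOrder S where
  le a b := ∃ e, IsIdempotentElem e ∧ a = e * b
  le_refl a := ⟨a * a⁻¹, idem_mul_inv a, (InverseSemigroup.mul_inv_mul a).symm⟩
  le_trans a b c := by
    rintro ⟨e, he, rfl⟩ ⟨f, hf, rfl⟩
    exact ⟨e * f, idem_mul he hf, (mul_assoc _ _ _).symm⟩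
  le_antisymm a b := by
    rintro ⟨e, he, h1⟩ ⟨f, hf, h2⟩
    have h3 : e * a = a := by
      rw [h1, ← mul_assoc, he]
    calc a = e * b := h1
      _ = e * (f * a) := by rw [← h2]
      _ = f * (e * a) := by
          rw [← mul_assoc, InverseSemigroup.idem_comm e f he hf, mul_assoc]
      _ = b := by rw [h3, ← h2]

theorem le_def {a b : S} : a ≤ b ↔ ∃ e, IsIdempotentElem e ∧ a = e * b := Iff.rfl

theorem le_iff_right {a b : S} : a ≤ b ↔ ∃ e, IsIdempotentElem e ∧ a = b * e := by
  constructor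
  · rintro ⟨e, he, rfl⟩
    refine ⟨b⁻¹ * e * b, by simpa [inv_inv'] using idem_conj b⁻¹ he, ?_⟩
    calc e * b = e * (b * b⁻¹) * b := by
            rw [mul_assoc, InverseSemigroup.mul_inv_mul]
      _ = (b * b⁻¹) * e * b := by rw [InverseSemigroup.idem_comm _ _ he (idem_mul_inv b)]
      _ = b * (b⁻¹ * e * b) := by simp only [mul_assoc]
  · rintro ⟨e, he, rfl⟩
    refine ⟨b * e * b⁻¹, idem_conj b he, ?_⟩
    calc b * e = b * (b⁻¹ * b) * e := by
            rw [← mul_assoc, InverseSemigroup.mul_inv_mul]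
      _ = b * ((b⁻¹ * b) * e) := by simp only [mul_assoc]
      _ = b * (e * (b⁻¹ * b)) := by rw [InverseSemigroup.idem_comm _ _ he (idem_inv_mul b)]
      _ = b * e * b⁻¹ * b := by simp only [mul_assoc]

theorem inv_le_inv' {a b : S} (h : a ≤ b) : a⁻¹ ≤ b⁻¹ := by
  obtain ⟨e, he, rfl⟩ := h
  exact le_iff_right.2 ⟨e, he, by rw [mul_inv_rev', inv_idem he]⟩

theorem idem_of_le {a e : S} (he : IsIdempotentElem e) (h : a ≤ e) : IsIdempotentElem a := by
  obtain ⟨f, hf, rfl⟩ := h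
  exact idem_mul hf he

theorem idem_le_iff {e f : S} (he : IsIdempotentElem e) (hf : IsIdempotentElem f) :
    e ≤ f ↔ f * e = e := by
  constructor
  · rintro ⟨g, hg, rfl⟩
    rw [InverseSemigroup.idem_comm f (g * f) hf he, mul_assoc, hf]
  · intro h
    exact ⟨e, he, by rw [InverseSemigroup.idem_comm e f he hf, h]⟩

/-- `a` and `b` are compatible if `a⁻¹ * b` and `a * b⁻¹` are idempotents. -/
def Compat (a b : S) : Prop := IsIdempotentElem (a⁻¹ * b) ∧ IsIdempotentElem (a * b⁻¹)

end InverseSemigroup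

/-- A Boolean inverse semigroup: an inverse semigroup with zero that has all binary compatible
joins, over which the multiplication distributes (joins are least upper bounds for the natural
partial order), and whose idempotents form a generalized Boolean algebra
(the meet of the idempotents `e`, `f` is `e * f`). -/
class BooleanInverseSemigroup (S : Type u) extends InverseSemigroup S, Zero S where
  zero_mul : ∀ a : S, 0 * a = 0
  mul_zero : ∀ a : S, a * 0 = 0
  exists_join : ∀ a b : S, Compat a b → ∃ c, IsLUB {a, b} c
  mul_join : ∀ x a b c : S, Compat a b → IsLUB {a, b} c → IsLUB {x * a, x * b} (x * c)
  join_mul : ∀ x a b c : S, Compat a b → IsLUB {a, b} c → IsLUB {a * x, b * x} (c * x)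
  exists_sdiff : ∀ e f : S, IsIdempotentElem e → IsIdempotentElem f →
    ∃ g, IsIdempotentElem g ∧ f * g = 0 ∧ IsLUB {e * f, g} e

section Boolean

open BooleanInverseSemigroup

variable {S : Type u} [BooleanInverseSemigroup S]

theorem compat_of_le {a b c : S} (ha : a ≤ c) (hb : b ≤ c) : Compat a b := by
  obtain ⟨e, he, rfl⟩ := ha
  obtain ⟨f, hf, rfl⟩ := hb
  refine ⟨?_, ?_⟩
  · rw [mul_inv_rev', inv_idem he]
    have := idem_conj c⁻¹ (idem_mul he hf)
    rw [inv_inv'] at this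
    simpa only [mul_assoc] using this
  · rw [mul_inv_rev', inv_idem hf]
    have := idem_mul (idem_mul he (idem_mul_inv c)) hf
    simpa only [mul_assoc] using this

theorem compat_of_lub {a b c : S} (h : IsLUB {a, b} c) : Compat a b :=
  compat_of_le (h.1 (by simp)) (h.1 (by simp))

theorem mulLub {a b c : S} (x : S) (h : IsLUB {a, b} c) : IsLUB {x * a, x * b} (x * c) :=
  mul_join x a b c (compat_of_lub h) h

theorem lubMul {a b c : S} (h : IsLUB {a, b} c) (x : S) : IsLUB {a * x, b * x} (c * x) :=
  join_mul x a b c (compat_of_lub h) h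

theorem idem_zero : IsIdempotentElem (0 : S) := BooleanInverseSemigroup.zero_mul 0

theorem zero_le' (a : S) : 0 ≤ a := ⟨0, idem_zero, (BooleanInverseSemigroup.zero_mul a).symm⟩

theorem lub_zero_right (a : S) : IsLUB {a, 0} a :=
  ⟨by rintro x (rfl | rfl); exacts [le_rfl, zero_le' _], fun _ h => h (by simp)⟩

theorem lub_zero_left (a : S) : IsLUB {0, a} a := by
  rw [Set.pair_comm]; exact lub_zero_right a

open Classical in
/-- The join `a ∨ b` of two elements (their least upper bound; the value is only meaningful
when `a` and `b` are compatible). -/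
noncomputable def join (a b : S) : S :=
  if h : ∃ c, IsLUB {a, b} c then h.choose else 0

theorem join_lub {a b : S} (h : Compat a b) : IsLUB {a, b} (join a b) := by
  have h' := exists_join a b h
  unfold join
  rw [dif_pos h']
  exact h'.choose_spec

theorem join_eq {a b c : S} (h : IsLUB {a, b} c) : join a b = c :=
  (join_lub (compat_of_lub h)).unique h

theorem compat_idem {e f : S} (he : IsIdempotentElem e) (hf : IsIdempotentElem f) :
    Compat e f := by
  refine ⟨?_, ?_⟩
  · rw [inv_idem he]; exact idem_mul he hf
  · rw [inv_idem hf]; exact idem_mul he hf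

theorem idem_of_lub {e f c : S} (he : IsIdempotentElem e) (hf : IsIdempotentElem f)
    (h : IsLUB {e, f} c) : IsIdempotentElem c := by
  have h1 : c⁻¹ = c := by
    have h2 : IsLUB {e, f} c⁻¹ := by
      refine ⟨?_, ?_⟩
      · rintro x (rfl | rfl)
        · rw [← inv_idem he]; exact inv_le_inv' (h.1 (by simp))
        · rw [← inv_idem hf]; exact inv_le_inv' (h.1 (by simp))
      · intro y hy
        rw [← inv_inv' y]
        apply inv_le_inv'
        apply h.2
        rintro x (rfl | rfl)
        · rw [← inv_idem he]; exact inv_le_inv' (hy (by simp))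
        · rw [← inv_idem hf]; exact inv_le_inv' (hy (by simp))
    exact h2.unique h
  have key : ∀ g, IsIdempotentElem g → g ≤ c → c * g = g := by
    intro g hg hgc
    obtain ⟨k, hk, hk'⟩ := hgc
    have h3 : g * c = g := by
      have : c * c⁻¹ * c = c := InverseSemigroup.mul_inv_mul c
      have hkg : k * g = g := by rw [hk', ← mul_assoc, hk]
      have h4 : IsIdempotentElem (c * c) := by
        have := idem_mul_inv c; rwa [h1] at this
      have h5 : g * (c * c) = g := by
        rw [hk', mul_assoc]
        rw [h1] at this
        rw [← mul_assoc c c c, this]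
      have h6 : k * (c * c) = g * c := by rw [hk', mul_assoc]
      have h7 : IsIdempotentElem (g * c) := by rw [← h6]; exact idem_mul hk h4
      have h8 : (g * c) * (g * c) = g * c := h7
      have h9 : g * (g * c) = g * c := by rw [← mul_assoc, hg]
      calc g * c = (g * c) * g := by
            rw [InverseSemigroup.idem_comm _ _ h7 hg, h9]
        _ = (g * c) * (g * (c * c)) := by rw [h5]
        _ = ((g * c) * (g * c)) * c := by simp only [mul_assoc]
        _ = g := by rw [h8, mul_assoc, h5]
    have h4 := congrArg (·⁻¹) h3
    simp only [mul_inv_rev', h1, inv_idem hg] at h4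
    exact h4
  have h3 := mulLub c h
  rw [key e he (h.1 (by simp)), key f hf (h.1 (by simp))] at h3
  exact h3.unique h

/-- The set of idempotents of `S`. -/
abbrev Idem (S : Type u) [BooleanInverseSemigroup S] := {e : S // IsIdempotentElem e}

theorem rel_compl_unique {e g h k : S} (hh : IsIdempotentElem h) (hk : IsIdempotentElem k)
    (h1 : e * h = 0) (h2 : IsLUB {e, h} g) (k1 : e * k = 0) (k2 : IsLUB {e, k} g)
    (he : IsIdempotentElem e) : h = k := by
  have hg : IsIdempotentElem g := idem_of_lub he hh h2
  have a1 : h * g = h := by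
    rw [InverseSemigroup.idem_comm h g hh hg]
    exact (idem_le_iff hh hg).1 (h2.1 (by simp))
  have a2 : k * g = k := by
    rw [InverseSemigroup.idem_comm k g hk hg]
    exact (idem_le_iff hk hg).1 (k2.1 (by simp))
  have b1 := mulLub h k2
  rw [InverseSemigroup.idem_comm h e hh he, h1, a1] at b1
  have b2 := mulLub k h2
  rw [InverseSemigroup.idem_comm k e hk he, k1, a2] at b2
  rw [b1.unique (lub_zero_left _), InverseSemigroup.idem_comm h k hh hk]
  exact (b2.unique (lub_zero_left _)).symm

open Classical in
/-- The relative complement `f \ e` of the idempotent `e` in the idempotent `f`. -/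
noncomputable def sdiff' (f e : Idem S) : S :=
  (exists_sdiff f.1 e.1 f.2 e.2).choose

theorem sdiff_idem (f e : Idem S) : IsIdempotentElem (sdiff' f e) :=
  (exists_sdiff f.1 e.1 f.2 e.2).choose_spec.1

theorem mul_sdiff (f e : Idem S) : e.1 * sdiff' f e = 0 :=
  (exists_sdiff f.1 e.1 f.2 e.2).choose_spec.2.1

theorem sdiff_mul (f e : Idem S) : sdiff' f e * e.1 = 0 := by
  rw [InverseSemigroup.idem_comm _ _ (sdiff_idem f e) e.2, mul_sdiff]

theorem sdiff_lub {f e : Idem S} (h : e.1 ≤ f.1) : IsLUB {e.1, sdiff' f e} f.1 := by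
  have h1 : IsLUB {f.1 * e.1, sdiff' f e} f.1 :=
    (exists_sdiff f.1 e.1 f.2 e.2).choose_spec.2.2
  rwa [(idem_le_iff e.2 f.2).1 h] at h1

theorem sdiff_le (f e : Idem S) : sdiff' f e ≤ f.1 :=
  (exists_sdiff f.1 e.1 f.2 e.2).choose_spec.2.2.1 (by simp [sdiff'])

/-- The local monoid `eSe`. -/
@[ext] structure LocalMonoid (e : Idem S) where
  val : S
  left : e.1 * val = val
  right : val * e.1 = val

noncomputable instance (e : Idem S) : Monoid (LocalMonoid e) where
  mul a b := ⟨a.val * b.val, by rw [← mul_assoc, a.left], by rw [mul_assoc, b.right]⟩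
  one := ⟨e.1, e.2, e.2⟩
  mul_assoc a b c := LocalMonoid.ext (mul_assoc _ _ _)
  one_mul a := LocalMonoid.ext a.left
  mul_one a := LocalMonoid.ext a.right

theorem LocalMonoid.mul_val {e : Idem S} (a b : LocalMonoid e) : (a * b).val = a.val * b.val := rfl

theorem LocalMonoid.one_val {e : Idem S} : (1 : LocalMonoid e).val = e.1 := rfl

theorem compat_sdiff {e : Idem S} (f : Idem S) (a : LocalMonoid e) :
    Compat a.val (sdiff' f e) := by
  have h1 : a.val⁻¹ * e.1 = a.val⁻¹ := by
    rw [← inv_idem e.2, ← mul_inv_rev', a.left]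
  refine ⟨?_, ?_⟩
  · rw [← h1, mul_assoc, mul_sdiff, BooleanInverseSemigroup.mul_zero]; exact idem_zero
  · rw [inv_idem (sdiff_idem f e), ← a.right, mul_assoc, mul_sdiff,
      BooleanInverseSemigroup.mul_zero]; exact idem_zero

/-- The homomorphism `a ↦ a ∨ (f \ e)` from `eSe` to `fSf`, where `e ≤ f`. -/
noncomputable def localHom {e f : Idem S} (h : e.1 ≤ f.1) : LocalMonoid e →* LocalMonoid f where
  toFun a := ⟨join a.val (sdiff' f e), by
      have h1 := join_lub (compat_sdiff f a)
      have h2 := mulLub f.1 h1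
      rw [(idem_le_iff (sdiff_idem f e) f.2).1 (sdiff_le f e)] at h2
      have h3 : f.1 * a.val = a.val := by
        rw [← a.left, ← mul_assoc, (idem_le_iff e.2 f.2).1 h]
      rw [h3] at h2
      exact h2.unique h1, by
      have h1 := join_lub (compat_sdiff f a)
      have h2 := lubMul h1 f.1
      rw [InverseSemigroup.idem_comm _ _ (sdiff_idem f e) f.2,
        (idem_le_iff (sdiff_idem f e) f.2).1 (sdiff_le f e)] at h2
      have h3 : a.val * f.1 = a.val := by
        rw [← a.right, mul_assoc, InverseSemigroup.idem_comm _ _ e.2 f.2,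
          (idem_le_iff e.2 f.2).1 h]
      rw [h3] at h2
      exact h2.unique h1⟩
  map_one' := LocalMonoid.ext (join_eq (sdiff_lub h))
  map_mul' a b := by
    apply LocalMonoid.ext
    apply join_eq
    have ha := join_lub (compat_sdiff f a)
    have hb := join_lub (compat_sdiff f b)
    have h1 := mulLub (join a.val (sdiff' f e)) hb
    have h2 := lubMul ha b.val
    have h3 := lubMul ha (sdiff' f e)
    have h4 : sdiff' f e * b.val = 0 := by
      rw [← b.left, ← mul_assoc, sdiff_mul, BooleanInverseSemigroup.zero_mul]
    have h5 : a.val * sdiff' f e = 0 := by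
      rw [← a.right, mul_assoc, mul_sdiff, BooleanInverseSemigroup.mul_zero]
    rw [h4] at h2
    rw [h5, (sdiff_idem f e : sdiff' f e * sdiff' f e = _)] at h3
    rw [h2.unique (lub_zero_right _), h3.unique (lub_zero_left _)] at h1
    exact h1

/-- The group of units `G_e` of the local monoid `eSe`. -/
abbrev LocalUnits (e : Idem S) := (LocalMonoid e)ˣ

/-- The structure map `φ : G_e → G_f`, `a ↦ a ∨ (f \ e)`, where `e ≤ f`. -/
noncomputable def phi {e f : Idem S} (h : e.1 ≤ f.1) : LocalUnits e →* LocalUnits f :=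
  Units.map (localHom h)

theorem phi_val {e f : Idem S} (h : e.1 ≤ f.1) (a : LocalUnits e) :
    (phi h a).val.val = join a.val.val (sdiff' f e) := rfl

theorem phi_refl {e : Idem S} (a : LocalUnits e) : phi (le_refl e.1) a = a := by
  apply Units.ext
  apply LocalMonoid.ext
  rw [phi_val]
  have h : sdiff' e e = 0 := by
    rw [← (idem_le_iff (sdiff_idem e e) e.2).1 (sdiff_le e e), mul_sdiff]
  rw [h]
  exact join_eq (lub_zero_right _)

theorem lub_assoc {a b c x y z : S} (h1 : IsLUB {a, b} x) (h2 : IsLUB {x, c} y)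
    (h3 : IsLUB {b, c} z) : IsLUB {a, z} y := by
  have hax : a ≤ x := h1.1 (by simp)
  have hbx : b ≤ x := h1.1 (by simp)
  have hxy : x ≤ y := h2.1 (by simp)
  have hcy : c ≤ y := h2.1 (by simp)
  refine ⟨?_, fun w hw => ?_⟩
  · rintro w (rfl | rfl)
    · exact hax.trans hxy
    · exact h3.2 (by rintro t (rfl | rfl); exacts [hbx.trans hxy, hcy])
  · have haw : a ≤ w := hw (by simp)
    have hzw : z ≤ w := hw (by simp)
    have hb : b ≤ w := (h3.1 (by simp) : b ≤ z).trans hzw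
    have hc : c ≤ w := (h3.1 (by simp) : c ≤ z).trans hzw
    exact h2.2 (by
      rintro t (rfl | rfl)
      · exact h1.2 (by rintro s (rfl | rfl); exacts [haw, hb])
      · exact hc)

theorem phi_trans {e f g : Idem S} (h1 : e.1 ≤ f.1) (h2 : f.1 ≤ g.1) (h3 : e.1 ≤ g.1)
    (a : LocalUnits e) : phi h2 (phi h1 a) = phi h3 a := by
  apply Units.ext
  apply LocalMonoid.ext
  rw [phi_val, phi_val]
  have hk := join_lub (compat_idem (sdiff_idem f e) (sdiff_idem g f))
  have hki := idem_of_lub (sdiff_idem f e) (sdiff_idem g f) hk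
  have hl := lub_assoc (sdiff_lub h1) (sdiff_lub h2) hk
  have he0 : e.1 * join (sdiff' f e) (sdiff' g f) = 0 := by
    have h := mulLub e.1 hk
    have h0 : e.1 * sdiff' g f = 0 := by
      rw [← (idem_le_iff e.2 f.2).1 h1, InverseSemigroup.idem_comm _ _ f.2 e.2, mul_assoc,
        mul_sdiff, BooleanInverseSemigroup.mul_zero]
    rw [mul_sdiff, h0] at h
    exact h.unique (lub_zero_left _)
  have hc : join (sdiff' f e) (sdiff' g f) = sdiff' g e :=
    rel_compl_unique hki (sdiff_idem g e) he0 hl (mul_sdiff g e) (sdiff_lub h3) e.2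
  have m1 := join_lub (compat_sdiff f a.val)
  have m2 := join_lub (compat_sdiff g (phi h1 a).val)
  rw [phi_val] at m2
  have m3 := lub_assoc m1 m2 hk
  rw [hc] at m3
  exact (join_eq m3).symm

/-- The join of two idempotents. -/
noncomputable def idemSup (e f : Idem S) : Idem S :=
  ⟨join e.1 f.1, idem_of_lub e.2 f.2 (join_lub (compat_idem e.2 f.2))⟩

theorem le_sup_l (e f : Idem S) : e.1 ≤ (idemSup e f).1 :=
  (join_lub (compat_idem e.2 f.2)).1 (by simp)

theorem le_sup_r (e f : Idem S) : f.1 ≤ (idemSup e f).1 :=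
  (join_lub (compat_idem e.2 f.2)).1 (by simp)

theorem idemSup_comm (e f : Idem S) : idemSup e f = idemSup f e := by
  apply Subtype.ext
  apply join_eq
  rw [Set.pair_comm]
  exact join_lub (compat_idem f.2 e.2)

theorem idemSup_self (e : Idem S) : idemSup e e = e := by
  apply Subtype.ext
  apply join_eq
  simp

theorem idemSup_assoc (e f g : Idem S) : idemSup (idemSup e f) g = idemSup e (idemSup f g) := by
  apply Subtype.ext
  symm
  apply join_eq
  exact lub_assoc (join_lub (compat_idem e.2 f.2)) (join_lub (compat_idem (idemSup e f).2 g.2))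
    (join_lub (compat_idem f.2 g.2))

/-- The underlying set of the Clifford semigroup `C(S)`: the disjoint union of the groups `G_e`. -/
structure Cliff (S : Type u) [BooleanInverseSemigroup S] where
  idem : Idem S
  unit : LocalUnits idem

theorem Cliff.ext_phi {x y : Cliff S} (h : x.idem = y.idem)
    (h' : ∀ g : Idem S, ∀ (h1 : x.idem.1 ≤ g.1) (h2 : y.idem.1 ≤ g.1), g = x.idem →
      phi h1 x.unit = phi h2 y.unit) : x = y := by
  obtain ⟨e, a⟩ := x
  obtain ⟨f, b⟩ := y
  obtain rfl : e = f := h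
  have := h' e le_rfl le_rfl rfl
  simp only [phi_refl] at this
  rw [this]

/-- The product of `C(S)`: `a ∘ b = φ(a) φ(b)` in `G_{e ∨ f}`, for `a ∈ G_e` and `b ∈ G_f`. -/
noncomputable instance : Mul (Cliff S) where
  mul x y := ⟨idemSup x.idem y.idem,
    phi (le_sup_l x.idem y.idem) x.unit * phi (le_sup_r x.idem y.idem) y.unit⟩

theorem Cliff.mul_def (x y : Cliff S) : x * y = ⟨idemSup x.idem y.idem,
    phi (le_sup_l x.idem y.idem) x.unit * phi (le_sup_r x.idem y.idem) y.unit⟩ := rfl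

theorem Cliff.mul_idem (x y : Cliff S) : (x * y).idem = idemSup x.idem y.idem := rfl

theorem Cliff.phi_mul (x y : Cliff S) {g : Idem S} (h : (x * y).idem.1 ≤ g.1) :
    phi h (x * y).unit = phi ((le_sup_l x.idem y.idem).trans h) x.unit *
      phi ((le_sup_r x.idem y.idem).trans h) y.unit := by
  change phi h (phi (le_sup_l x.idem y.idem) x.unit * phi (le_sup_r x.idem y.idem) y.unit) = _
  rw [map_mul, phi_trans, phi_trans]

theorem Cliff.idem_unit {x : Cliff S} (h : IsIdempotentElem x) : x = ⟨x.idem, 1⟩ := by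
  refine Cliff.ext_phi (x := x) (y := ⟨x.idem, 1⟩) rfl ?_
  intro g h1 h2 hg
  have h3 : (x * x).idem.1 ≤ g.1 := by
    rw [Cliff.mul_idem, idemSup_self]; exact h1
  have h4 := Cliff.phi_mul x x h3
  have h5 : phi h3 (x * x).unit = phi h1 x.unit := by
    have : ∀ y : Cliff S, y = x → ∀ hy : y.idem.1 ≤ g.1, phi hy y.unit = phi h1 x.unit := by
      rintro y rfl _; rfl
    exact this _ h h3
  rw [h5] at h4
  rw [map_one]
  exact left_eq_mul.1 h4

noncomputable instance : InverseSemigroup (Cliff S) where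
  inv x := ⟨x.idem, x.unit⁻¹⟩
  mul_assoc x y z := by
    apply Cliff.ext_phi
    · simp only [Cliff.mul_idem, idemSup_assoc]
    · intro g h1 h2 _
      simp only [Cliff.phi_mul, mul_assoc]
  mul_inv_mul x := by
    apply Cliff.ext_phi
    · simp only [Cliff.mul_idem, idemSup_self]
    · intro g h1 h2 _
      simp only [Cliff.phi_mul, map_inv, mul_inv_cancel, one_mul]
  inv_mul_inv x := by
    apply Cliff.ext_phi
    · simp only [Cliff.mul_idem, idemSup_self]
    · intro g h1 h2 _
      simp only [Cliff.phi_mul, map_inv, inv_mul_cancel, one_mul]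
  idem_comm x y hx hy := by
    rw [Cliff.idem_unit hx, Cliff.idem_unit hy]
    apply Cliff.ext_phi
    · simp only [Cliff.mul_idem]; exact idemSup_comm _ _
    · intro g h1 h2 _
      simp only [Cliff.phi_mul, map_one]

instance : Nonempty (Cliff S) := ⟨⟨⟨0, idem_zero⟩, 1⟩⟩

end Boolean

/-! ### The minimum group congruence -/

section Sigma

variable {T : Type u} [InverseSemigroup T]

/-- A congruence is a group congruence if the quotient semigroup is a group. -/
def IsGroupCon (c : Con T) : Prop :=
  ∃ one : c.Quotient, (∀ q, one * q = q) ∧ ∀ q, ∃ p, p * q = one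

/-- The minimum group congruence `σ`. -/
def sigma (T : Type u) [InverseSemigroup T] : Con T := sInf {c | IsGroupCon c}

theorem IsGroupCon.idem_rel {c : Con T} (hc : IsGroupCon c) {e f : T} (he : IsIdempotentElem e)
    (hf : IsIdempotentElem f) : c e f := by
  obtain ⟨one, h1, h2⟩ := hc
  have key : ∀ g : T, IsIdempotentElem g → (g : c.Quotient) = one := by
    intro g hg
    obtain ⟨p, hp⟩ := h2 g
    have h3 : (g : c.Quotient) * g = g := by rw [← Con.coe_mul, hg]
    have h4 : p * (g : c.Quotient) * g = p * (g * g) := by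
      refine Con.induction_on p fun p => ?_
      rw [← Con.coe_mul, ← Con.coe_mul, ← Con.coe_mul, ← Con.coe_mul, mul_assoc]
    calc (g : c.Quotient) = one * g := (h1 _).symm
      _ = p * (g * g) := by rw [← hp, h4]
      _ = one := by rw [h3, hp]
  exact (Con.eq c).1 ((key e he).trans (key f hf).symm)

theorem sigma_idem {e f : T} (he : IsIdempotentElem e) (hf : IsIdempotentElem f) :
    sigma T e f := fun _ hc => IsGroupCon.idem_rel hc he hf

theorem sigma_inv {a b : T} (h : sigma T a b) : sigma T a⁻¹ b⁻¹ := by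
  have h1 : sigma T a⁻¹ (a⁻¹ * (b * b⁻¹)) := by
    have := (sigma T).mul ((sigma T).refl a⁻¹) (sigma_idem (idem_mul_inv a) (idem_mul_inv b))
    rwa [← mul_assoc, InverseSemigroup.inv_mul_inv] at this
  have h2 : sigma T (a⁻¹ * (b * b⁻¹)) (a⁻¹ * a * b⁻¹) := by
    rw [← mul_assoc]
    exact (sigma T).mul ((sigma T).mul ((sigma T).refl _) ((sigma T).symm h)) ((sigma T).refl _)
  have h3 : sigma T (a⁻¹ * a * b⁻¹) b⁻¹ := by
    have := (sigma T).mul (sigma_idem (idem_inv_mul a) (idem_inv_mul b)) ((sigma T).refl b⁻¹)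
    rwa [InverseSemigroup.inv_mul_inv] at this
  exact (sigma T).trans (h1) ((sigma T).trans h2 h3)

/-- The group `T / σ`. -/
noncomputable instance [Nonempty T] : Group (sigma T).Quotient where
  mul_assoc a b c := Con.induction_on a fun a => Con.induction_on b fun b =>
    Con.induction_on c fun c => by
      rw [← Con.coe_mul, ← Con.coe_mul, ← Con.coe_mul, ← Con.coe_mul, mul_assoc]
  one := (((Classical.arbitrary T) * (Classical.arbitrary T)⁻¹ : T) : (sigma T).Quotient)
  one_mul a := Con.induction_on a fun a => by
    refine (Con.eq _).2 ?_
    have := (sigma T).mul (sigma_idem (idem_mul_inv (Classical.arbitrary T)) (idem_mul_inv a))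
      ((sigma T).refl a)
    rwa [InverseSemigroup.mul_inv_mul] at this
  mul_one a := Con.induction_on a fun a => by
    refine (Con.eq _).2 ?_
    have := (sigma T).mul ((sigma T).refl a)
      (sigma_idem (idem_mul_inv (Classical.arbitrary T)) (idem_inv_mul a))
    rwa [← mul_assoc a a⁻¹ a, InverseSemigroup.mul_inv_mul] at this
  inv := Quotient.map' (·⁻¹) fun _ _ h => sigma_inv h
  inv_mul_cancel a := Con.induction_on a fun a =>
    (Con.eq _).2 (sigma_idem (idem_inv_mul a) (idem_mul_inv _))

/-- `σ` is itself a group congruence, hence the least one. -/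
theorem sigma_isGroupCon [Nonempty T] : IsGroupCon (sigma T) :=
  ⟨1, one_mul, fun q => ⟨q⁻¹, inv_mul_cancel q⟩⟩

end Sigma

/-- The group of units `U(S) = C(S) / σ` of a Boolean inverse semigroup. -/
abbrev UnitGroup (S : Type u) [BooleanInverseSemigroup S] := (sigma (Cliff S)).Quotient

end BISG

/-! ### Groupoids -/

namespace BISG

open Set Topology

universe u

/-- A groupoid as a set with a partial operation: `comp g h` (the product `gh`) is defined iff
`dom g = ran h`. -/
class AlgGroupoid (G : Type u) where
  dom : G → G
  ran : G → G
  inv : G → G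
  comp : ∀ g h : G, dom g = ran h → G
  dom_dom : ∀ g, dom (dom g) = dom g
  ran_dom : ∀ g, ran (dom g) = dom g
  dom_ran : ∀ g, dom (ran g) = ran g
  ran_ran : ∀ g, ran (ran g) = ran g
  dom_comp : ∀ g h p, dom (comp g h p) = dom h
  ran_comp : ∀ g h p, ran (comp g h p) = ran g
  comp_assoc : ∀ g h k (p : dom g = ran h) (q : dom h = ran k),
    comp (comp g h p) k ((dom_comp g h p).trans q) =
      comp g (comp h k q) (p.trans (ran_comp h k q).symm)
  comp_dom : ∀ g, comp g (dom g) (ran_dom g).symm = g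
  ran_comp_self : ∀ g, comp (ran g) g (dom_ran g) = g
  dom_inv : ∀ g, dom (inv g) = ran g
  ran_inv : ∀ g, ran (inv g) = dom g
  comp_inv : ∀ g, comp g (inv g) (ran_inv g).symm = ran g
  inv_comp : ∀ g, comp (inv g) g (dom_inv g) = dom g

section AlgGroupoid

open AlgGroupoid

variable {G : Type u} [AlgGroupoid G]

/-- The set `G_o` of identities of `G`. -/
def units (G : Type u) [AlgGroupoid G] : Set G := {g | dom g = g}

theorem dom_mem (g : G) : dom g ∈ units G := dom_dom g

theorem ran_mem (g : G) : ran g ∈ units G := dom_ran g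

theorem ran_unit {e : G} (h : e ∈ units G) : ran e = e := by
  have h' : dom e = e := h
  rw [← h', ran_dom]

theorem comp_congr {g g' h h' : G} (hg : g = g') (hh : h = h') (p : dom g = ran h)
    (p' : dom g' = ran h') : comp g h p = comp g' h' p' := by
  subst hg; subst hh; rfl

theorem unit_comp {e g : G} (he : e ∈ units G) (p : dom e = ran g) : comp e g p = g := by
  have h : e = ran g := by rw [← p]; exact (show dom e = e from he).symm
  rw [comp_congr h rfl p (dom_ran g), ran_comp_self]

theorem comp_unit {e g : G} (he : e ∈ units G) (p : dom g = ran e) : comp g e p = g := by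
  have h : e = dom g := by rw [p, ran_unit he]
  rw [comp_congr rfl h p (ran_dom g).symm, comp_dom]

theorem eq_of_inv_comp {a b : G} (p : dom (inv a) = ran b)
    (h : comp (inv a) b p ∈ units G) : a = b := by
  have p1 : dom a = ran (inv a) := (ran_inv a).symm
  have h1 := comp_assoc a (inv a) b p1 p
  rw [comp_unit h] at h1
  rw [comp_congr (comp_inv a) rfl _ (by rw [dom_ran, ← p, dom_inv])] at h1
  rw [unit_comp (ran_mem a)] at h1
  exact h1.symm

theorem eq_of_comp_inv {a b : G} (p : dom a = ran (inv b))
    (h : comp a (inv b) p ∈ units G) : a = b := by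
  have p1 : dom (inv b) = ran b := dom_inv b
  have h1 := comp_assoc a (inv b) b p p1
  rw [unit_comp h] at h1
  rw [h1, comp_congr rfl (inv_comp b) _ (by rw [ran_dom, p, ran_inv])]
  exact (comp_unit (dom_mem b) _).symm

theorem inv_inv_g (a : G) : inv (inv a) = a := by
  apply eq_of_comp_inv (by rw [dom_inv])
  rw [inv_comp]
  exact dom_mem _

theorem inv_unit {e : G} (h : e ∈ units G) : inv e = e := by
  have h1 := comp_inv e
  rw [unit_comp h, ran_unit h] at h1
  exact h1

/-- Subset multiplication: `AB` is the set of all defined products `ab`, `a ∈ A`, `b ∈ B`. -/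
def setMul (A B : Set G) : Set G := {k | ∃ g ∈ A, ∃ h ∈ B, ∃ p, comp g h p = k}

/-- `A⁻¹` is the set of inverses of the elements of `A`. -/
def setInv (A : Set G) : Set G := inv '' A

/-- Local bisections: `A⁻¹A` and `AA⁻¹` are sets of identities. -/
def IsLocalBisection (A : Set G) : Prop :=
  setMul (setInv A) A ⊆ units G ∧ setMul A (setInv A) ⊆ units G

/-- Bisections: `A⁻¹A` and `AA⁻¹` are both the set of all identities. -/
def IsBisection (A : Set G) : Prop :=
  setMul (setInv A) A = units G ∧ setMul A (setInv A) = units G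

theorem IsBisection.isLocalBisection {A : Set G} (h : IsBisection A) : IsLocalBisection A :=
  ⟨h.1.subset, h.2.subset⟩

theorem setMul_mono {A A' B B' : Set G} (h : A ⊆ A') (h' : B ⊆ B') :
    setMul A B ⊆ setMul A' B' := by
  rintro _ ⟨g, hg, k, hk, p, rfl⟩
  exact ⟨g, h hg, k, h' hk, p, rfl⟩

theorem setMul_assoc (A B C : Set G) : setMul (setMul A B) C = setMul A (setMul B C) := by
  ext x
  constructor
  · rintro ⟨_, ⟨a, ha, b, hb, p, rfl⟩, c, hc, q, rfl⟩
    have q' : dom b = ran c := by rw [← q, dom_comp]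
    exact ⟨a, ha, comp b c q', ⟨b, hb, c, hc, q', rfl⟩, by rw [p, ran_comp],
      (comp_assoc a b c p q').symm⟩
  · rintro ⟨a, ha, _, ⟨b, hb, c, hc, q, rfl⟩, p, rfl⟩
    have p' : dom a = ran b := by rw [p, ran_comp]
    exact ⟨comp a b p', ⟨a, ha, b, hb, p', rfl⟩, c, hc, by rw [dom_comp, q],
      comp_assoc a b c p' q⟩

theorem setMul_union_right (A B C : Set G) : setMul A (B ∪ C) = setMul A B ∪ setMul A C := by
  ext x
  constructor
  · rintro ⟨a, ha, b, hb | hb, p, rfl⟩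
    · exact Or.inl ⟨a, ha, b, hb, p, rfl⟩
    · exact Or.inr ⟨a, ha, b, hb, p, rfl⟩
  · rintro (⟨a, ha, b, hb, p, rfl⟩ | ⟨a, ha, b, hb, p, rfl⟩)
    · exact ⟨a, ha, b, Or.inl hb, p, rfl⟩
    · exact ⟨a, ha, b, Or.inr hb, p, rfl⟩

theorem setMul_union_left (A B C : Set G) : setMul (A ∪ B) C = setMul A C ∪ setMul B C := by
  ext x
  constructor
  · rintro ⟨a, ha | ha, b, hb, p, rfl⟩
    · exact Or.inl ⟨a, ha, b, hb, p, rfl⟩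
    · exact Or.inr ⟨a, ha, b, hb, p, rfl⟩
  · rintro (⟨a, ha, b, hb, p, rfl⟩ | ⟨a, ha, b, hb, p, rfl⟩)
    · exact ⟨a, Or.inl ha, b, hb, p, rfl⟩
    · exact ⟨a, Or.inr ha, b, hb, p, rfl⟩

theorem units_mul (A : Set G) : setMul (units G) A = A := by
  ext x
  constructor
  · rintro ⟨e, he, a, ha, p, rfl⟩
    rwa [unit_comp he]
  · intro hx
    exact ⟨ran x, ran_mem x, x, hx, dom_ran x, ran_comp_self x⟩

theorem mul_units (A : Set G) : setMul A (units G) = A := by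
  ext x
  constructor
  · rintro ⟨a, ha, e, he, p, rfl⟩
    rwa [comp_unit he]
  · intro hx
    exact ⟨x, hx, dom x, dom_mem x, (ran_dom x).symm, comp_dom x⟩

theorem setInv_setInv (A : Set G) : setInv (setInv A) = A := by
  simp [setInv, image_image, inv_inv_g]

theorem setInv_units : setInv (units G) = units G := by
  ext x
  constructor
  · rintro ⟨e, he, rfl⟩
    rwa [inv_unit he]
  · intro hx
    exact ⟨x, hx, inv_unit hx⟩

theorem isLocalBisection_iff {A : Set G} :
    IsLocalBisection A ↔ InjOn (dom : G → G) A ∧ InjOn (ran : G → G) A := by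
  constructor
  · rintro ⟨h1, h2⟩
    refine ⟨fun a ha b hb h => ?_, fun a ha b hb h => ?_⟩
    · have p : dom a = ran (inv b) := by rw [h, ran_inv]
      exact eq_of_comp_inv p (h2 ⟨a, ha, inv b, ⟨b, hb, rfl⟩, p, rfl⟩)
    · have p : dom (inv a) = ran b := by rw [← h, dom_inv]
      exact eq_of_inv_comp p (h1 ⟨inv a, ⟨a, ha, rfl⟩, b, hb, p, rfl⟩)
  · rintro ⟨h1, h2⟩
    constructor
    · rintro _ ⟨_, ⟨a, ha, rfl⟩, b, hb, p, rfl⟩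
      have : a = b := h2 ha hb (by rw [← dom_inv, p])
      subst this
      rw [inv_comp]
      exact dom_mem a
    · rintro _ ⟨a, ha, _, ⟨b, hb, rfl⟩, p, rfl⟩
      have : a = b := h1 ha hb (by rw [p, ran_inv])
      subst this
      rw [comp_inv]
      exact ran_mem a

theorem IsLocalBisection.mul {A B : Set G} (hA : IsLocalBisection A) (hB : IsLocalBisection B) :
    IsLocalBisection (setMul A B) := by
  rw [isLocalBisection_iff] at *
  constructor
  · rintro _ ⟨a, ha, b, hb, p, rfl⟩ _ ⟨a', ha', b', hb', p', rfl⟩ h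
    rw [dom_comp, dom_comp] at h
    obtain rfl := hB.1 hb hb' h
    obtain rfl := hA.1 ha ha' (p.trans p'.symm)
    rfl
  · rintro _ ⟨a, ha, b, hb, p, rfl⟩ _ ⟨a', ha', b', hb', p', rfl⟩ h
    rw [ran_comp, ran_comp] at h
    obtain rfl := hA.2 ha ha' h
    obtain rfl := hB.2 hb hb' (p.symm.trans p')
    rfl

theorem IsLocalBisection.inv {A : Set G} (hA : IsLocalBisection A) :
    IsLocalBisection (setInv A) := by
  refine ⟨?_, ?_⟩
  · rw [setInv_setInv]; exact hA.2
  · rw [setInv_setInv]; exact hA.1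

theorem isLocalBisection_of_subset_units {A : Set G} (h : A ⊆ units G) : IsLocalBisection A := by
  rw [isLocalBisection_iff]
  constructor
  · intro a ha b hb hab
    rwa [show dom a = a from h ha, show dom b = b from h hb] at hab
  · intro a ha b hb hab
    rwa [ran_unit (h ha), ran_unit (h hb)] at hab

theorem mul_inv_mul_set {A : Set G} (hA : IsLocalBisection A) :
    setMul (setMul A (setInv A)) A = A := by
  ext x
  constructor
  · rintro ⟨e, he, a, ha, p, rfl⟩
    rwa [unit_comp (hA.2 he)]
  · intro hx
    exact ⟨_, ⟨x, hx, inv x, ⟨x, hx, rfl⟩, (ran_inv x).symm, comp_inv x⟩, x, hx, dom_ran x,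
      ran_comp_self x⟩

theorem setMul_of_units {E F : Set G} (hE : E ⊆ units G) (hF : F ⊆ units G) :
    setMul E F = E ∩ F := by
  ext x
  constructor
  · rintro ⟨e, he, f, hf, p, rfl⟩
    have : e = f := by
      rw [← show dom e = e from hE he, p, ran_unit (hF hf)]
    subst this
    rw [unit_comp (hE he)]
    exact ⟨he, hf⟩
  · rintro ⟨he, hf⟩
    exact ⟨x, he, x, hf, by rw [ran_unit (hF hf)]; exact hE he, unit_comp (hE he) _⟩

theorem subset_units_of_idem {A : Set G} (hA : IsLocalBisection A) (h : setMul A A = A) :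
    A ⊆ units G := by
  intro x hx
  rw [isLocalBisection_iff] at hA
  have hx' := hx
  rw [← h] at hx'
  obtain ⟨b, hb, c, hc, p, hbc⟩ := hx'
  have h1 : c = x := hA.1 hc hx (by rw [← hbc, dom_comp])
  have h2 : b = x := hA.2 hb hx (by rw [← hbc, ran_comp])
  subst h1
  subst h2
  have p1 : dom (inv b) = ran b := dom_inv b
  have h3 := comp_assoc (inv b) b b p1 p
  rw [comp_congr rfl hbc _ p1,
    comp_congr (inv_comp b) rfl _ (by rw [dom_dom, p]), unit_comp (dom_mem b), inv_comp] at h3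
  exact h3.symm

theorem setMul_inv_self_ran {A : Set G} (hA : IsLocalBisection A) :
    setMul A (setInv A) = ran '' A := by
  ext x
  constructor
  · rintro ⟨a, ha, _, ⟨b, hb, rfl⟩, p, rfl⟩
    have : a = b := (isLocalBisection_iff.1 hA).1 ha hb (by rw [p, ran_inv])
    subst this
    exact ⟨a, ha, (comp_inv a).symm⟩
  · rintro ⟨a, ha, rfl⟩
    exact ⟨a, ha, inv a, ⟨a, ha, rfl⟩, (ran_inv a).symm, comp_inv a⟩

theorem setInv_mul (A B : Set G) :
    setInv (setMul A B) = setMul (setInv B) (setInv A) := by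
  have key : ∀ a b : G, ∀ p : dom a = ran b, ∀ q : dom (inv b) = ran (inv a),
      inv (comp a b p) = comp (inv b) (inv a) q := by
    intro a b p q
    apply eq_of_inv_comp (by rw [inv_inv_g, ran_comp, ran_inv, dom_comp])
    rw [comp_congr (inv_inv_g (comp a b p)) rfl _ (by rw [ran_comp, ran_inv, dom_comp])]
    have q1 : dom b = ran (comp (inv b) (inv a) q) := by rw [ran_comp, ran_inv]
    rw [comp_assoc a b (comp (inv b) (inv a) q) p q1]
    have q2 : dom b = ran (inv b) := (ran_inv b).symm
    have h1 := comp_assoc b (inv b) (inv a) q2 q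
    rw [comp_congr (comp_inv b) rfl _ (by rw [dom_ran, ← q, dom_inv]),
      unit_comp (ran_mem b)] at h1
    rw [comp_congr rfl h1.symm _ (ran_inv a).symm, comp_inv]
    exact ran_mem a
  ext x
  constructor
  · rintro ⟨_, ⟨a, ha, b, hb, p, rfl⟩, rfl⟩
    have q : dom (inv b) = ran (inv a) := by rw [dom_inv, ran_inv, p]
    exact ⟨inv b, ⟨b, hb, rfl⟩, inv a, ⟨a, ha, rfl⟩, q, (key a b p q).symm⟩
  · rintro ⟨_, ⟨b, hb, rfl⟩, _, ⟨a, ha, rfl⟩, q, rfl⟩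
    have p : dom a = ran b := by rw [← ran_inv a, ← dom_inv b, q]
    exact ⟨comp a b p, ⟨a, ha, b, hb, p, rfl⟩, key a b p q⟩

theorem range_dom : range (dom : G → G) = units G := by
  ext x
  constructor
  · rintro ⟨g, rfl⟩; exact dom_mem g
  · intro hx; exact ⟨x, hx⟩

theorem setMul_eq_image (A B : Set G) : setMul A B =
    (fun p : {p : G × G // dom p.1 = ran p.2} => comp p.1.1 p.1.2 p.2) ''
      (Subtype.val ⁻¹' (A ×ˢ B)) := by
  ext x
  constructor
  · rintro ⟨a, ha, b, hb, p, rfl⟩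
    exact ⟨⟨(a, b), p⟩, ⟨ha, hb⟩, rfl⟩
  · rintro ⟨⟨⟨a, b⟩, p⟩, ⟨ha, hb⟩, rfl⟩
    exact ⟨a, ha, b, hb, p, rfl⟩

theorem IsBisection.mul {A B : Set G} (hA : IsBisection A) (hB : IsBisection B) :
    IsBisection (setMul A B) := by
  constructor
  · rw [setInv_mul, setMul_assoc,
      ← setMul_assoc (setInv A), hA.1, units_mul, hB.1]
  · rw [setInv_mul, setMul_assoc,
      ← setMul_assoc B, hB.2, units_mul, hA.2]

theorem IsBisection.inv {A : Set G} (hA : IsBisection A) : IsBisection (setInv A) := by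
  constructor
  · rw [setInv_setInv]; exact hA.2
  · rw [setInv_setInv]; exact hA.1

end AlgGroupoid

/-! ### Boolean groupoids -/

/-- A Boolean groupoid: an étale topological groupoid whose space of identities is a locally
compact Boolean space. -/
class BooleanGroupoid (G : Type u) [AlgGroupoid G] [TopologicalSpace G] : Prop where
  continuous_inv : Continuous (AlgGroupoid.inv : G → G)
  continuous_comp : Continuous fun p : {p : G × G // AlgGroupoid.dom p.1 = AlgGroupoid.ran p.2} =>
    AlgGroupoid.comp p.1.1 p.1.2 p.2
  etale : IsLocalHomeomorph (AlgGroupoid.dom : G → G)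
  t2 : T2Space (units G)
  locallyCompact : LocallyCompactSpace (units G)
  zeroDimensional : TopologicalSpace.IsTopologicalBasis {U : Set (units G) | IsClopen U}

section BooleanGroupoid

open AlgGroupoid BooleanGroupoid

variable {G : Type u} [AlgGroupoid G] [TopologicalSpace G]

instance [BooleanGroupoid G] : T2Space (units G) := t2

instance [BooleanGroupoid G] : LocallyCompactSpace (units G) := locallyCompact

theorem isOpen_units [BooleanGroupoid G] : IsOpen (units G) := by
  rw [← range_dom]
  exact (etale (G := G)).isOpenMap.isOpen_range

theorem continuous_dom [BooleanGroupoid G] : Continuous (dom : G → G) := etale.continuous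

theorem continuous_ran [BooleanGroupoid G] : Continuous (ran : G → G) := by
  have : (ran : G → G) = dom ∘ inv := by ext g; exact (dom_inv g).symm
  rw [this]
  exact continuous_dom.comp continuous_inv

theorem isClosed_composable [BooleanGroupoid G] :
    IsClosed {p : G × G | dom p.1 = ran p.2} := by
  have h1 : Continuous fun p : G × G => (⟨dom p.1, dom_mem p.1⟩ : units G) :=
    (continuous_dom.comp continuous_fst).subtype_mk _
  have h2 : Continuous fun p : G × G => (⟨ran p.2, ran_mem p.2⟩ : units G) :=
    (continuous_ran.comp continuous_snd).subtype_mk _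
  have := isClosed_eq h1 h2
  simpa only [Subtype.mk.injEq] using this

theorem isCompact_setMul [BooleanGroupoid G] {A B : Set G} (hA : IsCompact A)
    (hB : IsCompact B) : IsCompact (setMul A B) := by
  rw [setMul_eq_image]
  apply IsCompact.image _ continuous_comp
  exact (isClosed_composable (G := G)).isClosedEmbedding_subtypeVal.isCompact_preimage (hA.prod hB)

theorem isOpen_setInv [BooleanGroupoid G] {A : Set G} (hA : IsOpen A) : IsOpen (setInv A) := by
  have : setInv A = inv ⁻¹' A := by
    ext x
    constructor
    · rintro ⟨a, ha, rfl⟩; rwa [mem_preimage, inv_inv_g]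
    · intro hx; exact ⟨inv x, hx, inv_inv_g x⟩
  rw [this]
  exact hA.preimage BooleanGroupoid.continuous_inv

theorem isCompact_setInv [BooleanGroupoid G] {A : Set G} (hA : IsCompact A) :
    IsCompact (setInv A) := hA.image BooleanGroupoid.continuous_inv

theorem isOpen_setMul [BooleanGroupoid G] {A B : Set G} (hA : IsOpen A) (hB : IsOpen B) :
    IsOpen (setMul A B) := by
  rw [isOpen_iff_mem_nhds]
  rintro _ ⟨a, ha, b, hb, p, rfl⟩
  obtain ⟨e, hbe, he⟩ := (etale (G := G)) b
  have hde : ∀ x ∈ e.target, dom (e.symm x) = x := by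
    intro x hx
    have := e.right_inv hx
    rwa [← he] at this
  have hdb : dom b ∈ e.target := by
    have := e.map_source hbe
    rwa [← he] at this
  have hsb : e.symm (dom b) = b := by
    have := e.left_inv hbe
    rwa [← he] at this
  let W : Set G := dom ⁻¹' e.target
  have hW : IsOpen W := e.open_target.preimage continuous_dom
  let s : W → G := fun g => e.symm (dom g.1)
  have hs : Continuous s := by
    rw [continuous_iff_continuousAt]
    intro g
    exact (e.symm.continuousAt (x := dom g.1) (by exact g.2)).comp
      (f := fun g : W => dom g.1) (continuous_dom.comp continuous_subtype_val).continuousAt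
  have hq : ∀ g : W, dom g.1 = ran (inv (s g)) := by
    intro g; rw [ran_inv, hde _ g.2]
  let t : W → G := fun g => comp g.1 (inv (s g)) (hq g)
  have ht : Continuous t := by
    have h1 : Continuous fun g : W =>
        (⟨(g.1, inv (s g)), hq g⟩ : {p : G × G // dom p.1 = ran p.2}) :=
      (continuous_subtype_val.prodMk (continuous_inv.comp hs)).subtype_mk _
    exact continuous_comp.comp h1
  have hopen : IsOpen (Subtype.val '' (t ⁻¹' A ∩ s ⁻¹' B)) :=
    hW.isOpenMap_subtype_val _ ((hA.preimage ht).inter (hB.preimage hs))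
  refine Filter.mem_of_superset (hopen.mem_nhds ?_) ?_
  · have hcW : comp a b p ∈ W := by
      change dom (comp a b p) ∈ e.target
      rwa [dom_comp]
    have hsc : s ⟨comp a b p, hcW⟩ = b := by
      change e.symm (dom (comp a b p)) = b
      rw [dom_comp, hsb]
    refine ⟨⟨comp a b p, hcW⟩, ⟨?_, ?_⟩, rfl⟩
    · have : t ⟨comp a b p, hcW⟩ = a := by
        change comp (comp a b p) (inv (s _)) _ = a
        rw [comp_congr rfl (congrArg inv hsc) _ (by rw [dom_comp, ran_inv]),
          comp_assoc a b (inv b) p (ran_inv b).symm,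
          comp_congr rfl (comp_inv b) _ (by rw [ran_ran, p])]
        exact comp_unit (ran_mem b) _
      rw [mem_preimage, this]; exact ha
    · rw [mem_preimage, hsc]; exact hb
  · rintro _ ⟨g, ⟨hg1, hg2⟩, rfl⟩
    have q1 : dom (t g) = ran (s g) := by
      change dom (comp _ _ _) = _
      rw [dom_comp, dom_inv]
    refine ⟨t g, hg1, s g, hg2, q1, ?_⟩
    change comp (comp g.1 (inv (s g)) (hq g)) (s g) q1 = g.1
    rw [comp_assoc g.1 (inv (s g)) (s g) (hq g) (dom_inv _),
      comp_congr rfl (inv_comp (s g)) _ (by rw [ran_dom, hde _ g.2])]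
    exact comp_unit (dom_mem _) _

theorem diff_isOpen [BooleanGroupoid G] {E F : Set G} (hE : IsOpen E) (hEu : E ⊆ units G)
    (hF : IsCompact F) (hFu : F ⊆ units G) : IsOpen (E \ F) := by
  have h1 : IsCompact (Subtype.val ⁻¹' F : Set (units G)) := by
    rw [Topology.IsInducing.subtypeVal.isCompact_iff, Subtype.image_preimage_coe,
      inter_eq_right.2 hFu]
    exact hF
  have h2 : IsOpen (Subtype.val ⁻¹' E \ Subtype.val ⁻¹' F : Set (units G)) :=
    (hE.preimage continuous_subtype_val).sdiff h1.isClosed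
  have h3 := isOpen_units.isOpenMap_subtype_val _ h2
  have h4 : Subtype.val '' (Subtype.val ⁻¹' E \ Subtype.val ⁻¹' F : Set (units G)) = E \ F := by
    rw [← preimage_sdiff, Subtype.image_preimage_coe,
      inter_eq_right.2 (sdiff_subset.trans hEu)]
  rwa [h4] at h3

/-- `KB(G)`: the compact-open local bisections of `G`. -/
@[ext] structure KB (G : Type u) [AlgGroupoid G] [TopologicalSpace G] where
  carrier : Set G
  isOpen : IsOpen carrier
  isCompact : IsCompact carrier
  isLocalBisection : IsLocalBisection carrier

instance [BooleanGroupoid G] : Mul (KB G) where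
  mul A B := ⟨setMul A.carrier B.carrier, isOpen_setMul A.isOpen B.isOpen,
    isCompact_setMul A.isCompact B.isCompact, A.isLocalBisection.mul B.isLocalBisection⟩

instance [BooleanGroupoid G] : Inv (KB G) where
  inv A := ⟨setInv A.carrier, isOpen_setInv A.isOpen, isCompact_setInv A.isCompact,
    A.isLocalBisection.inv⟩

instance : Zero (KB G) where
  zero := ⟨∅, isOpen_empty, isCompact_empty, isLocalBisection_of_subset_units (empty_subset _)⟩

theorem KB.mul_carrier [BooleanGroupoid G] (A B : KB G) :
    (A * B).carrier = setMul A.carrier B.carrier := rfl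

theorem KB.inv_carrier [BooleanGroupoid G] (A : KB G) : A⁻¹.carrier = setInv A.carrier := rfl

theorem KB.zero_carrier : (0 : KB G).carrier = ∅ := rfl

theorem KB.idem_iff [BooleanGroupoid G] {A : KB G} :
    IsIdempotentElem A ↔ A.carrier ⊆ units G := by
  constructor
  · intro h
    exact subset_units_of_idem A.isLocalBisection (congrArg KB.carrier h)
  · intro h
    apply KB.ext
    rw [KB.mul_carrier, setMul_of_units h h, inter_self]

instance [BooleanGroupoid G] : InverseSemigroup (KB G) where
  mul_assoc A B C := KB.ext (setMul_assoc _ _ _)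
  mul_inv_mul A := KB.ext (mul_inv_mul_set A.isLocalBisection)
  inv_mul_inv A := by
    apply KB.ext
    have := mul_inv_mul_set A.isLocalBisection.inv
    rwa [setInv_setInv] at this
  idem_comm E F hE hF := by
    rw [KB.idem_iff] at hE hF
    apply KB.ext
    rw [KB.mul_carrier, KB.mul_carrier, setMul_of_units hE hF, setMul_of_units hF hE, inter_comm]

theorem KB.le_iff [BooleanGroupoid G] {A B : KB G} : A ≤ B ↔ A.carrier ⊆ B.carrier := by
  constructor
  · rintro ⟨E, hE, rfl⟩
    rw [KB.idem_iff] at hE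
    rintro _ ⟨e, he, b, hb, p, rfl⟩
    rwa [unit_comp (hE he)]
  · intro h
    refine ⟨A * A⁻¹, idem_mul_inv A, ?_⟩
    apply KB.ext
    apply Subset.antisymm
    · have : setMul (setMul A.carrier (setInv A.carrier)) A.carrier ⊆
          setMul (setMul A.carrier (setInv A.carrier)) B.carrier := setMul_mono Subset.rfl h
      rwa [mul_inv_mul_set A.isLocalBisection] at this
    · rintro _ ⟨e, he, b, hb, p, rfl⟩
      have he' : e ∈ units G := A.isLocalBisection.2 he
      rw [unit_comp he']
      have he2 : e ∈ setMul A.carrier (setInv A.carrier) := he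
      rw [setMul_inv_self_ran A.isLocalBisection] at he2
      obtain ⟨a, ha, rfl⟩ := he2
      have : a = b := (isLocalBisection_iff.1 B.isLocalBisection).2 (h ha) hb
        (by rw [← p, dom_ran])
      rwa [← this]

theorem KB.lub_of_union [BooleanGroupoid G] {A B C : KB G}
    (h : C.carrier = A.carrier ∪ B.carrier) : IsLUB {A, B} C := by
  refine ⟨?_, fun D hD => ?_⟩
  · rintro D (rfl | rfl)
    · rw [KB.le_iff, h]; exact subset_union_left
    · rw [KB.le_iff, h]; exact subset_union_right
  · rw [KB.le_iff, h]
    exact union_subset (KB.le_iff.1 (hD (by simp))) (KB.le_iff.1 (hD (by simp)))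

theorem KB.compat_union [BooleanGroupoid G] {A B : KB G} (h : Compat A B) :
    IsLocalBisection (A.carrier ∪ B.carrier) := by
  obtain ⟨h1, h2⟩ := h
  rw [KB.idem_iff] at h1 h2
  have k1 : ∀ a ∈ A.carrier, ∀ b ∈ B.carrier, dom a = dom b → a = b := by
    intro a ha b hb hab
    have p : dom a = ran (inv b) := by rw [ran_inv, hab]
    exact eq_of_comp_inv p (h2 ⟨a, ha, inv b, ⟨b, hb, rfl⟩, p, rfl⟩)
  have k2 : ∀ a ∈ A.carrier, ∀ b ∈ B.carrier, ran a = ran b → a = b := by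
    intro a ha b hb hab
    have p : dom (inv a) = ran b := by rw [dom_inv, hab]
    exact eq_of_inv_comp p (h1 ⟨inv a, ⟨a, ha, rfl⟩, b, hb, p, rfl⟩)
  have hA := isLocalBisection_iff.1 A.isLocalBisection
  have hB := isLocalBisection_iff.1 B.isLocalBisection
  rw [isLocalBisection_iff]
  constructor
  · rintro a (ha | ha) b (hb | hb) hab
    · exact hA.1 ha hb hab
    · exact k1 a ha b hb hab
    · exact (k1 b hb a ha hab.symm).symm
    · exact hB.1 ha hb hab
  · rintro a (ha | ha) b (hb | hb) hab
    · exact hA.2 ha hb hab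
    · exact k2 a ha b hb hab
    · exact (k2 b hb a ha hab.symm).symm
    · exact hB.2 ha hb hab

/-- The union of two compatible compact-open local bisections. -/
def KB.union [BooleanGroupoid G] (A B : KB G) (h : Compat A B) : KB G :=
  ⟨A.carrier ∪ B.carrier, A.isOpen.union B.isOpen, A.isCompact.union B.isCompact,
    KB.compat_union h⟩

theorem KB.lub_carrier [BooleanGroupoid G] {A B C : KB G} (h : Compat A B)
    (hC : IsLUB {A, B} C) : C.carrier = A.carrier ∪ B.carrier := by
  rw [hC.unique (KB.lub_of_union (C := KB.union A B h) rfl)]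
  rfl

/-- The Boolean inverse semigroup `KB(G)`, under subset multiplication. -/
instance [BooleanGroupoid G] : BooleanInverseSemigroup (KB G) where
  zero_mul A := by
    apply KB.ext
    rw [KB.mul_carrier, KB.zero_carrier]
    ext x
    simp [setMul]
  mul_zero A := by
    apply KB.ext
    rw [KB.mul_carrier, KB.zero_carrier]
    ext x
    simp [setMul]
  exists_join A B h := ⟨KB.union A B h, KB.lub_of_union rfl⟩
  mul_join X A B C h hC := KB.lub_of_union (by
    rw [KB.mul_carrier, KB.mul_carrier, KB.mul_carrier, KB.lub_carrier h hC, setMul_union_right])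
  join_mul X A B C h hC := KB.lub_of_union (by
    rw [KB.mul_carrier, KB.mul_carrier, KB.mul_carrier, KB.lub_carrier h hC, setMul_union_left])
  exists_sdiff E F hE hF := by
    rw [KB.idem_iff] at hE hF
    have hD : E.carrier \ F.carrier ⊆ units G := sdiff_subset.trans hE
    refine ⟨⟨E.carrier \ F.carrier, diff_isOpen E.isOpen hE F.isCompact hF,
      E.isCompact.diff F.isOpen, isLocalBisection_of_subset_units hD⟩, KB.idem_iff.2 hD, ?_, ?_⟩
    · apply KB.ext
      rw [KB.mul_carrier, setMul_of_units hF hD, KB.zero_carrier]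
      exact inter_sdiff_self _ _
    · apply KB.lub_of_union
      rw [KB.mul_carrier, setMul_of_units hE hF]
      exact (inter_union_sdiff _ _).symm

/-- The topological full group: the compact-open bisections of `G`. -/
@[ext] structure TopFullGroup (G : Type u) [AlgGroupoid G] [TopologicalSpace G] where
  carrier : Set G
  isOpen : IsOpen carrier
  isCompact : IsCompact carrier
  isBisection : IsBisection carrier

/-- The group structure (subset multiplication) on the compact-open bisections of a Boolean
groupoid whose space of identities is compact. -/
instance [BooleanGroupoid G] [CompactSpace (units G)] : Group (TopFullGroup G) where
  mul A B := ⟨setMul A.carrier B.carrier, isOpen_setMul A.isOpen B.isOpen,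
    isCompact_setMul A.isCompact B.isCompact, A.isBisection.mul B.isBisection⟩
  one := ⟨units G, isOpen_units, isCompact_iff_compactSpace.2 inferInstance, by
    constructor <;> rw [setInv_units, units_mul]⟩
  inv A := ⟨setInv A.carrier, isOpen_setInv A.isOpen, isCompact_setInv A.isCompact,
    A.isBisection.inv⟩
  mul_assoc A B C := TopFullGroup.ext (setMul_assoc _ _ _)
  one_mul A := TopFullGroup.ext (units_mul _)
  mul_one A := TopFullGroup.ext (mul_units _)
  inv_mul_cancel A := TopFullGroup.ext A.isBisection.1

end BooleanGroupoid

/-! ### The groupoid `G^∞` -/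

/-- The set `G^∞ = G ∪ {∞}`. -/
inductive Ginf (G : Type u) : Type u
  | of : G → Ginf G
  | infty : Ginf G

namespace Ginf

open AlgGroupoid BooleanGroupoid

section Alg

variable {G : Type u}

theorem of_injective : Function.Injective (of : G → Ginf G) := fun _ _ h => of.inj h

/-- The extension to `G^∞` of a self-map of `G`, fixing `∞`. -/
def ext' (f : G → G) : Ginf G → Ginf G
  | of g => of (f g)
  | infty => infty

variable [AlgGroupoid G]

/-- The product of `G^∞`: that of `G`, together with `∞ ∞ = ∞`. -/
def comp' : ∀ x y : Ginf G, ext' dom x = ext' ran y → Ginf G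
  | of g, of h, p => of (comp g h (of.inj p))
  | infty, infty, _ => infty

/-- The groupoid `G^∞`, in which `∞` is a new identity. -/
instance : AlgGroupoid (Ginf G) where
  dom := ext' dom
  ran := ext' ran
  inv := ext' AlgGroupoid.inv
  comp := comp'
  dom_dom := by rintro (g | _); exacts [congrArg of (dom_dom g), rfl]
  ran_dom := by rintro (g | _); exacts [congrArg of (ran_dom g), rfl]
  dom_ran := by rintro (g | _); exacts [congrArg of (dom_ran g), rfl]
  ran_ran := by rintro (g | _); exacts [congrArg of (ran_ran g), rfl]
  dom_comp := by
    rintro (g | _) (h | _) p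
    exacts [congrArg of (dom_comp g h _), (nomatch p), (nomatch p), rfl]
  ran_comp := by
    rintro (g | _) (h | _) p
    exacts [congrArg of (ran_comp g h _), (nomatch p), (nomatch p), rfl]
  comp_assoc := by
    rintro (g | _) (h | _) (k | _) p q
    exacts [congrArg of (comp_assoc g h k _ _), (nomatch q), (nomatch p), (nomatch p),
      (nomatch p), (nomatch p), (nomatch q), rfl]
  comp_dom := by rintro (g | _); exacts [congrArg of (comp_dom g), rfl]
  ran_comp_self := by rintro (g | _); exacts [congrArg of (ran_comp_self g), rfl]
  dom_inv := by rintro (g | _); exacts [congrArg of (dom_inv g), rfl]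
  ran_inv := by rintro (g | _); exacts [congrArg of (ran_inv g), rfl]
  comp_inv := by rintro (g | _); exacts [congrArg of (comp_inv g), rfl]
  inv_comp := by rintro (g | _); exacts [congrArg of (inv_comp g), rfl]

/-- The inclusion into `G^∞` of the one-point compactification of `G_o`. -/
def incl : OnePoint (units G) → Ginf G := fun x => x.elim infty fun e => of e.1

theorem incl_injective : Function.Injective (incl : OnePoint (units G) → Ginf G) := by
  intro x y h
  induction x with
  | infty => induction y with
    | infty => rfl
    | coe y => exact nomatch h
  | coe x => induction y with
    | infty => exact nomatch h
    | coe y => exact congrArg _ (Subtype.ext (of.inj h))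

theorem range_incl : range (incl : OnePoint (units G) → Ginf G) = units (Ginf G) := by
  ext x
  constructor
  · rintro ⟨y, rfl⟩
    induction y with
    | infty => rfl
    | coe y => exact congrArg of y.2
  · intro hx
    cases x with
    | of g => exact ⟨OnePoint.some ⟨g, of.inj hx⟩, rfl⟩
    | infty => exact ⟨OnePoint.infty, rfl⟩

theorem mem_range (x : Ginf G) : x ∈ range (of : G → Ginf G) ∨
    x ∈ range (incl : OnePoint (units G) → Ginf G) := by
  cases x with
  | of g => exact Or.inl ⟨g, rfl⟩
  | infty => exact Or.inr ⟨OnePoint.infty, rfl⟩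

end Alg

variable {G : Type u} [AlgGroupoid G] [TopologicalSpace G]

/-- The topology of `G^∞`, generated by the open subsets of `G` and the open subsets of the
one-point compactification of `G_o`. -/
instance : TopologicalSpace (Ginf G) := TopologicalSpace.generateFrom
  ({U | ∃ V : Set G, IsOpen V ∧ U = of '' V} ∪
    {U | ∃ W : Set (OnePoint (units G)), IsOpen W ∧ U = incl '' W})

theorem isOpenMap_of : IsOpenMap (of : G → Ginf G) := fun V hV =>
  TopologicalSpace.isOpen_generateFrom_of_mem (Or.inl ⟨V, hV, rfl⟩)

theorem isOpenMap_incl : IsOpenMap (incl : OnePoint (units G) → Ginf G) := fun W hW =>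
  TopologicalSpace.isOpen_generateFrom_of_mem (Or.inr ⟨W, hW, rfl⟩)

theorem continuous_of [BooleanGroupoid G] : Continuous (of : G → Ginf G) := by
  apply continuous_generateFrom_iff.2
  rintro _ (⟨V, hV, rfl⟩ | ⟨W, hW, rfl⟩)
  · rwa [preimage_image_eq _ of_injective]
  · have h : (of : G → Ginf G) ⁻¹' (incl '' W) =
        Subtype.val '' ((OnePoint.some : units G → OnePoint (units G)) ⁻¹' W) := by
      ext g
      constructor
      · rintro ⟨x, hx, hxg⟩
        induction x with
        | infty => exact nomatch hxg
        | coe x => exact ⟨x, hx, of.inj hxg⟩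
      · rintro ⟨x, hx, rfl⟩
        exact ⟨x, hx, rfl⟩
    rw [h]
    exact isOpen_units.isOpenMap_subtype_val _ (hW.preimage OnePoint.continuous_coe)

theorem continuous_incl [BooleanGroupoid G] :
    Continuous (incl : OnePoint (units G) → Ginf G) := by
  apply continuous_generateFrom_iff.2
  rintro _ (⟨V, hV, rfl⟩ | ⟨W, hW, rfl⟩)
  · have h : (incl : OnePoint (units G) → Ginf G) ⁻¹' (of '' V) =
        (OnePoint.some : units G → OnePoint (units G)) '' (Subtype.val ⁻¹' V) := by
      ext x
      constructor
      · rintro ⟨g, hg, hgx⟩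
        induction x with
        | infty => exact nomatch hgx
        | coe x =>
          refine ⟨x, ?_, rfl⟩
          rw [mem_preimage, ← of.inj hgx]; exact hg
      · rintro ⟨x, hx, rfl⟩
        exact ⟨x.1, hx, rfl⟩
    rw [h]
    exact OnePoint.isOpenMap_coe _ (hV.preimage continuous_subtype_val)
  · rwa [preimage_image_eq _ incl_injective]

theorem isOpenEmbedding_of [BooleanGroupoid G] : IsOpenEmbedding (of : G → Ginf G) :=
  .of_continuous_injective_isOpenMap continuous_of of_injective isOpenMap_of

theorem isOpenEmbedding_incl [BooleanGroupoid G] :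
    IsOpenEmbedding (incl : OnePoint (units G) → Ginf G) :=
  .of_continuous_injective_isOpenMap continuous_incl incl_injective isOpenMap_incl

theorem isLocalHomeomorph_dom [BooleanGroupoid G] :
    IsLocalHomeomorph (dom : Ginf G → Ginf G) := by
  have h1 : IsLocalHomeomorph ((dom : Ginf G → Ginf G) ∘ (of : G → Ginf G)) :=
    (isOpenEmbedding_of.isLocalHomeomorph.comp etale : IsLocalHomeomorph (of ∘ (dom : G → G)))
  have h2 : IsLocalHomeomorph ((dom : Ginf G → Ginf G) ∘ (incl : OnePoint (units G) → _)) := by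
    have : (dom : Ginf G → Ginf G) ∘ (incl : OnePoint (units G) → _) = incl := by
      ext1 x
      have hx : incl x ∈ units (Ginf G) := by rw [← range_incl]; exact ⟨x, rfl⟩
      exact hx
    rw [this]
    exact isOpenEmbedding_incl.isLocalHomeomorph
  have h3 := h1.isLocalHomeomorphOn (s := univ).of_comp_right
    isOpenEmbedding_of.isLocalHomeomorph.isLocalHomeomorphOn
  have h4 := h2.isLocalHomeomorphOn (s := univ).of_comp_right
    isOpenEmbedding_incl.isLocalHomeomorph.isLocalHomeomorphOn
  rw [image_univ] at h3 h4
  intro x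
  rcases mem_range x with h | h
  · exact h3 x h
  · exact h4 x h

theorem continuous_inv' [BooleanGroupoid G] :
    Continuous (AlgGroupoid.inv : Ginf G → Ginf G) := by
  rw [continuous_iff_continuousAt]
  intro x
  rcases mem_range x with ⟨g, rfl⟩ | ⟨y, rfl⟩
  · rw [← isOpenEmbedding_of.continuousAt_iff]
    exact (continuous_of.comp BooleanGroupoid.continuous_inv).continuousAt
  · rw [← isOpenEmbedding_incl.continuousAt_iff]
    have : (AlgGroupoid.inv : Ginf G → Ginf G) ∘ incl = incl := by
      ext1 x
      have hx : incl x ∈ units (Ginf G) := by rw [← range_incl]; exact ⟨x, rfl⟩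
      exact inv_unit hx
    rw [this]
    exact continuous_incl.continuousAt

theorem continuous_comp' [BooleanGroupoid G] :
    Continuous fun p : {p : Ginf G × Ginf G // dom p.1 = ran p.2} =>
      comp p.1.1 p.1.2 p.2 := by
  rw [continuous_iff_continuousAt]
  rintro ⟨⟨x | _, y | _⟩, p⟩
  · let i : {p : G × G // dom p.1 = ran p.2} → {p : Ginf G × Ginf G // dom p.1 = ran p.2} :=
      fun p => ⟨(of p.1.1, of p.1.2), congrArg of p.2⟩
    have hi : Continuous i := ((continuous_of.comp (continuous_fst.comp
      continuous_subtype_val)).prodMk (continuous_of.comp (continuous_snd.comp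
      continuous_subtype_val))).subtype_mk _
    have hemb : IsEmbedding i := by
      apply IsEmbedding.of_comp hi continuous_subtype_val
      exact (isOpenEmbedding_of.isEmbedding.prodMap isOpenEmbedding_of.isEmbedding).comp
        IsEmbedding.subtypeVal
    have hrange : range i = Subtype.val ⁻¹'
        (range (of : G → Ginf G) ×ˢ range (of : G → Ginf G)) := by
      ext ⟨⟨a, b⟩, q⟩
      constructor
      · rintro ⟨r, hr⟩
        have := congrArg Subtype.val hr
        simp only [i, Prod.mk.injEq] at this
        exact ⟨⟨_, this.1⟩, ⟨_, this.2⟩⟩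
      · rintro ⟨⟨c, rfl⟩, ⟨d, rfl⟩⟩
        exact ⟨⟨(c, d), of.inj q⟩, rfl⟩
    have hopen : IsOpenEmbedding i := ⟨hemb, by
      rw [hrange]
      exact (isOpenEmbedding_of.isOpen_range.prod isOpenEmbedding_of.isOpen_range).preimage
        continuous_subtype_val⟩
    have key : ContinuousAt ((fun p : {p : Ginf G × Ginf G // dom p.1 = ran p.2} =>
      comp p.1.1 p.1.2 p.2) ∘ i) ⟨(x, y), of.inj p⟩ :=
      (continuous_of.comp BooleanGroupoid.continuous_comp).continuousAt
    exact hopen.continuousAt_iff.1 key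
  · exact nomatch p
  · exact nomatch p
  · have h1 : ContinuousAt (fun p : {p : Ginf G × Ginf G // dom p.1 = ran p.2} => p.1.2)
        ⟨(infty, infty), p⟩ := (continuous_snd.comp continuous_subtype_val).continuousAt
    refine h1.congr ?_
    have hO : IsOpen (units (Ginf G)) := by
      rw [← range_incl]; exact isOpenEmbedding_incl.isOpen_range
    have hO' : IsOpen ((fun p : {p : Ginf G × Ginf G // dom p.1 = ran p.2} => p.1.1) ⁻¹'
        units (Ginf G)) := hO.preimage (continuous_fst.comp continuous_subtype_val)
    filter_upwards [hO'.mem_nhds (show (infty : Ginf G) ∈ units (Ginf G) from rfl)] with q hq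
    exact (unit_comp hq q.2).symm

/-- The identity space of `G^∞` is the one-point compactification of `G_o`. -/
noncomputable def unitsHomeo [BooleanGroupoid G] :
    OnePoint (units G) ≃ₜ units (Ginf G) :=
  (isOpenEmbedding_incl.isEmbedding.toHomeomorph).trans (Homeomorph.setCongr range_incl)

theorem exists_compactOpen [BooleanGroupoid G] (x : units G) {V : Set (units G)} (hV : IsOpen V)
    (hx : x ∈ V) : ∃ K : Set (units G), IsOpen K ∧ IsCompact K ∧ x ∈ K ∧ K ⊆ V := by
  obtain ⟨C, hC, hxC⟩ := exists_compact_mem_nhds x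
  obtain ⟨U, hU, hxU, hUC⟩ := (zeroDimensional (G := G)).exists_subset_of_mem_open
    (show x ∈ interior C ∩ V from ⟨mem_interior_iff_mem_nhds.2 hxC, hx⟩)
    (isOpen_interior.inter hV)
  exact ⟨U, hU.isOpen, hC.of_isClosed_subset hU.isClosed
    (fun y hy => interior_subset (hUC hy).1), hxU, fun y hy => (hUC hy).2⟩

instance [BooleanGroupoid G] : TotallySeparatedSpace (OnePoint (units G)) := by
  rw [totallySeparatedSpace_iff_exists_isClopen]
  have key : ∀ (x : units G) (z : OnePoint (units G)), (x : OnePoint (units G)) ≠ z →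
      ∃ U : Set (OnePoint (units G)), IsClopen U ∧ (x : OnePoint (units G)) ∈ U ∧ z ∈ Uᶜ := by
    intro x z hxz
    have hV : IsOpen ((OnePoint.some : units G → OnePoint (units G)) ⁻¹' {z}ᶜ) :=
      isOpen_compl_singleton.preimage OnePoint.continuous_coe
    obtain ⟨K, hK1, hK2, hxK, hKV⟩ := exists_compactOpen x hV hxz
    refine ⟨OnePoint.some '' K, ⟨?_, OnePoint.isOpenMap_coe _ hK1⟩, ⟨x, hxK, rfl⟩, ?_⟩
    · exact (hK2.image OnePoint.continuous_coe).isClosed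
    · rintro ⟨y, hy, rfl⟩
      exact hKV hy rfl
  intro x y hxy
  induction x with
  | coe x => exact key x y hxy
  | infty =>
    induction y with
    | infty => exact absurd rfl hxy
    | coe y =>
      obtain ⟨U, hU, h1, h2⟩ := key y _ hxy.symm
      exact ⟨Uᶜ, hU.compl, h2, by rwa [compl_compl]⟩

instance [BooleanGroupoid G] : CompactSpace (units (Ginf G)) :=
  (unitsHomeo (G := G)).compactSpace

/-- `G^∞` is a Boolean groupoid. -/
instance [BooleanGroupoid G] : BooleanGroupoid (Ginf G) := by
  have h2 : T2Space (units (Ginf G)) := (unitsHomeo (G := G)).t2Space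
  have h3 : TotallyDisconnectedSpace (units (Ginf G)) :=
    (unitsHomeo (G := G)).symm.isEmbedding.isTotallyDisconnected_range.1
      (isTotallyDisconnected_of_totallyDisconnectedSpace _)
  exact
    { continuous_inv := continuous_inv'
      continuous_comp := continuous_comp'
      etale := isLocalHomeomorph_dom
      t2 := h2
      locallyCompact := inferInstance
      zeroDimensional := isTopologicalBasis_isClopen }

end Ginf

end BISG

/-! The semigroup `Cliff S` is glued from the groups `G_e` along the maps `phi`, indexed by the
idempotents, any two of which have a join. A group congruence identifies all idempotents, hence an
element with each of its images under `phi`; so `U(S)` is the directed colimit of the groups `G_e`.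
`UnitGroup.nonempty_mulEquiv` records what is needed to recognise this colimit as a given group.

For `S = KB(G)` an idempotent is a compact-open set `E` of identities, and a unit of `eSe` is a
compact-open `A` with `A⁻¹A = AA⁻¹ = E`. Let `G` lie in a Boolean groupoid `H` with compact identity
space, as an open subgroupoid containing every arrow that starts in it. Then `A ∪ (H_o \ E)` is a
compact-open bisection of `H`: the added piece is open because `E` is compact in a Hausdorff space,
and compact because `E` is open in a compact one. The map is multiplicative (`extend_mul`), since
`A` is supported on `E` and the cross terms vanish. It is constant along `phi` (`extend_phi`), since
`phi` only adds identities. It is injective on the colimit (`phi_eq_of_extend_eq`), since `A` is the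
part of the bisection whose domains lie in `E`. It is onto if every compact-open bisection of `H`
contains all identities outside some compact-open `E ⊆ G_o` (`extend_surjective`).

For `H = G^∞` this last condition holds because the only arrow starting at `∞` is `∞` itself. A
bisection `B` therefore contains `∞`, and being open it contains all identities outside a compact
subset of `G_o`, which is covered by a compact-open set. For the second isomorphism, `G^∞` is
embedded in itself by the identity map, and `E` is the whole compact identity space. -/

namespace BISG

universe u v

/-! ### The unit group as a directed colimit of the groups `G_e`. -/

section UnitGroup

variable {S : Type u} [BooleanInverseSemigroup S]

theorem Cliff.isIdempotentElem_one (g : Idem S) : IsIdempotentElem (⟨g, 1⟩ : Cliff S) := by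
  apply Cliff.ext_phi
  · exact idemSup_self g
  · intro k h1 h2 _
    simp only [Cliff.phi_mul, map_one, mul_one]

/-- This expresses `phi` inside the semigroup `Cliff S`, as multiplication by an idempotent, so that
congruences can see it. -/
theorem Cliff.mul_one_idem (x : Cliff S) (g : Idem S) (h : x.idem.1 ≤ g.1) :
    x * ⟨g, 1⟩ = ⟨g, phi h x.unit⟩ := by
  apply Cliff.ext_phi
  · apply Subtype.ext
    refine join_eq ⟨?_, fun c hc => hc (by simp)⟩
    rintro c (rfl | rfl)
    exacts [h, le_rfl]
  · intro k h1 h2 _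
    simp only [Cliff.phi_mul, map_one, mul_one, phi_trans h h2 (h.trans h2)]

/-- Since `sigma` identifies all idempotents, the factor `x⁻¹ x` in `x = x (x⁻¹ x)` can be exchanged
for the identity of `G_g`. -/
theorem Cliff.sigma_phi (x : Cliff S) (g : Idem S) (h : x.idem.1 ≤ g.1) :
    sigma (Cliff S) x ⟨g, phi h x.unit⟩ := by
  have h1 := (sigma (Cliff S)).mul ((sigma (Cliff S)).refl x)
    (sigma_idem (idem_inv_mul x) (Cliff.isIdempotentElem_one g))
  rwa [← mul_assoc, InverseSemigroup.mul_inv_mul, Cliff.mul_one_idem x g h] at h1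

/-- A surjective homomorphism from `C(S)` onto a group that identifies two elements only if
their images in some common group `G_g` agree induces an isomorphism from `U(S)`. -/
theorem UnitGroup.nonempty_mulEquiv {H : Type v} [Group H] (f : Cliff S →ₙ* H)
    (hf : Function.Surjective f)
    (hinj : ∀ x y : Cliff S, f x = f y → ∃ (g : Idem S) (hx : x.idem.1 ≤ g.1)
      (hy : y.idem.1 ≤ g.1), phi hx x.unit = phi hy y.unit) :
    Nonempty (UnitGroup S ≃* H) := by
  -- `f` only preserves products; that the identity of `H` is hit by this element follows because it
  -- is idempotent, and a group has only one idempotent.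
  have hone : f ⟨⟨0, idem_zero⟩, 1⟩ = 1 := by
    have h := congrArg f (Cliff.isIdempotentElem_one (⟨0, idem_zero⟩ : Idem S)).eq
    rw [map_mul] at h
    exact mul_eq_left.1 h
  have hker : ∀ x y : Cliff S, sigma (Cliff S) x y ↔ f x = f y := by
    intro x y
    constructor
    · intro h
      -- As `sigma` is an infimum, it suffices that the kernel of `f` is a group congruence. Left
      -- inverses are supplied by surjectivity of `f`.
      refine h (Con.ker f) ⟨((⟨⟨0, idem_zero⟩, 1⟩ : Cliff S) : (Con.ker f).Quotient), ?_, ?_⟩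
      · intro q
        refine Con.induction_on q fun a => ?_
        rw [← Con.coe_mul]
        refine (Con.eq _).2 ?_
        change f (_ * a) = f a
        rw [map_mul, hone, one_mul]
      · intro q
        refine Con.induction_on q fun a => ?_
        obtain ⟨b, hb⟩ := hf (f a)⁻¹
        refine ⟨(b : (Con.ker f).Quotient), ?_⟩
        rw [← Con.coe_mul]
        refine (Con.eq _).2 ?_
        change f (b * a) = f _
        rw [map_mul, hone, hb, inv_mul_cancel]
    · intro h
      obtain ⟨g, hx, hy, hxy⟩ := hinj x y h
      -- Both elements are `sigma`-related to their common image in `G_g`.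
      have h1 := Cliff.sigma_phi x g hx
      rw [hxy] at h1
      exact (sigma (Cliff S)).trans h1 ((sigma (Cliff S)).symm (Cliff.sigma_phi y g hy))
  let F : UnitGroup S → H := fun q => Con.liftOn q f fun x y h => (hker x y).1 h
  have hF : Function.Bijective F := by
    constructor
    · intro p q
      refine Con.induction_on p fun x => Con.induction_on q fun y => ?_
      intro h
      exact (Con.eq _).2 ((hker x y).2 h)
    · intro z
      obtain ⟨x, rfl⟩ := hf z
      exact ⟨(x : (sigma (Cliff S)).Quotient), rfl⟩
  refine ⟨{ Equiv.ofBijective F hF with map_mul' := ?_ }⟩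
  intro p q
  refine Con.induction_on p fun x => Con.induction_on q fun y => ?_
  exact map_mul f x y

end UnitGroup

open Set Topology AlgGroupoid

/-! ### Extending a set supported on `E` by the identities outside `E`. -/

section Extend

variable {H : Type u} [AlgGroupoid H]

/-- The subset `A ∪ (H_o \ E)`, extending `A ⊆ E A E` by the identities outside `E`. -/
def extendUnits (E A : Set H) : Set H := A ∪ (units H \ E)

theorem setInv_union (A B : Set H) : setInv (A ∪ B) = setInv A ∪ setInv B := image_union _ _ _

theorem setInv_of_subset_units {A : Set H} (h : A ⊆ units H) : setInv A = A := by
  have : EqOn (inv : H → H) id A := fun x hx => inv_unit (h hx)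
  rw [setInv, this.image_eq, image_id]

theorem setMul_empty_right (A : Set H) : setMul A ∅ = ∅ := by
  ext x; simp [setMul]

theorem setMul_empty_left (A : Set H) : setMul ∅ A = ∅ := by
  ext x; simp [setMul]

/-- A cross term in the product of two extensions: `A = AE`, and `E` is disjoint from its complement
in the identities. -/
theorem setMul_diff_eq_empty {E A : Set H} (hE : E ⊆ units H) (h : setMul A E = A) :
    setMul A (units H \ E) = ∅ := by
  rw [← h, setMul_assoc, setMul_of_units hE sdiff_subset, inter_sdiff_self, setMul_empty_right]

theorem diff_setMul_eq_empty {E A : Set H} (hE : E ⊆ units H) (h : setMul E A = A) :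
    setMul (units H \ E) A = ∅ := by
  rw [← h, ← setMul_assoc, setMul_of_units sdiff_subset hE, inter_comm, inter_sdiff_self,
    setMul_empty_left]

/-- Distributing over the unions gives four terms. The two mixed ones are empty, and the identities
outside `E` multiply to themselves. -/
theorem extendUnits_mul {E A B : Set H} (hE : E ⊆ units H) (hA : setMul A E = A)
    (hB : setMul E B = B) :
    setMul (extendUnits E A) (extendUnits E B) = extendUnits E (setMul A B) := by
  rw [extendUnits, extendUnits, setMul_union_left, setMul_union_right, setMul_union_right,
    setMul_diff_eq_empty hE hA, diff_setMul_eq_empty hE hB,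
    setMul_of_units sdiff_subset sdiff_subset, inter_self, union_empty, empty_union, extendUnits]

theorem extendUnits_inv (E A : Set H) :
    setInv (extendUnits E A) = extendUnits E (setInv A) := by
  rw [extendUnits, setInv_union, setInv_of_subset_units (A := units H \ E) sdiff_subset,
    extendUnits]

theorem extendUnits_self {E : Set H} (hE : E ⊆ units H) : extendUnits E E = units H :=
  union_sdiff_cancel hE

/-- The identities outside `E` split into those in `F \ E` and those outside `F`. This is why
passing from `G_e` to `G_f` does not change the extension. -/
theorem extendUnits_trans {E F A : Set H} (hF : F ⊆ units H) (hEF : E ⊆ F) :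
    extendUnits F (A ∪ (F \ E)) = extendUnits E A := by
  rw [extendUnits, extendUnits, union_assoc]
  congr 1
  ext x
  simp only [mem_union, mem_sdiff]
  constructor
  · rintro (⟨h1, h2⟩ | ⟨h1, h2⟩)
    exacts [⟨hF h1, h2⟩, ⟨h1, fun h => h2 (hEF h)⟩]
  · rintro ⟨h1, h2⟩
    by_cases h : x ∈ F
    exacts [Or.inl ⟨h, h2⟩, Or.inr ⟨h1, h⟩]

/-- Elements of `A = AE` have domain in `E`, whereas an added identity is its own domain and lies
outside `E`. Hence a point of `A` found in the other extension must come from `B`. -/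
theorem subset_of_extendUnits_eq {E A B : Set H} (hA : setMul A E = A)
    (hE : E ⊆ units H) (h : extendUnits E A = extendUnits E B) : A ⊆ B := by
  intro x hx
  have h1 : x ∈ extendUnits E B := h ▸ Or.inl hx
  refine h1.resolve_right fun h2 => h2.2 ?_
  rw [← hA] at hx
  obtain ⟨a, ha, e, he, p, rfl⟩ := hx
  have h3 : dom (comp a e p) = comp a e p := h2.1
  rw [dom_comp, show dom e = e from hE he] at h3
  rwa [← h3]

/-- Inversion commutes with extension, so both products are the extension of `E` itself, which is
the whole set of identities. -/
theorem extendUnits_isBisection {E A : Set H} (hE : E ⊆ units H) (hA : setMul A E = A)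
    (hA' : setMul E A = A) (h1 : setMul (setInv A) A = E) (h2 : setMul A (setInv A) = E) :
    IsBisection (extendUnits E A) := by
  have h3 : setMul (setInv A) E = setInv A := by
    rw [← setInv_of_subset_units hE, ← setInv_mul, hA']
  have h4 : setMul E (setInv A) = setInv A := by
    rw [← setInv_of_subset_units hE, ← setInv_mul, hA]
  constructor
  · rw [extendUnits_inv, extendUnits_mul hE h3 hA', h1, extendUnits_self hE]
  · rw [extendUnits_inv, extendUnits_mul hE hA h4, h2, extendUnits_self hE]

theorem setInv_mul_self_dom {A : Set H} (hA : IsLocalBisection A) :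
    setMul (setInv A) A = dom '' A := by
  have h := setMul_inv_self_ran hA.inv
  rw [setInv_setInv] at h
  rw [h, setInv, image_image]
  simp only [ran_inv]

/-- A bisection is the extension by identities of its restriction to any `E` outside which it
consists of identities. -/
theorem IsBisection.extendUnits_inter {B E : Set H} (hB : IsBisection B)
    (h : units H \ E ⊆ B) (hE : E ⊆ units H) :
    extendUnits E (B ∩ dom ⁻¹' E) = B ∧ dom '' (B ∩ dom ⁻¹' E) = E ∧
      ran '' (B ∩ dom ⁻¹' E) = E := by
  have hinj := isLocalBisection_iff.1 hB.isLocalBisection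
  have hd : dom '' B = units H := by rw [← setInv_mul_self_dom hB.isLocalBisection, hB.1]
  have hr : ran '' B = units H := by rw [← setMul_inv_self_ran hB.isLocalBisection, hB.2]
  refine ⟨?_, ?_, ?_⟩
  · apply Subset.antisymm
    · exact union_subset inter_subset_left h
    · intro b hb
      by_cases hbE : dom b ∈ E
      · exact Or.inl ⟨hb, hbE⟩
      -- The identity `dom b` is itself in `B` and shares its domain with `b`, so the two coincide.
      · have h1 : dom b ∈ units H \ E := ⟨dom_mem b, hbE⟩
        have h2 : dom b = b := hinj.1 (h h1) hb (dom_dom b)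
        rw [h2] at h1
        exact Or.inr h1
  · apply Subset.antisymm
    · rintro _ ⟨b, hb, rfl⟩; exact hb.2
    · intro x hx
      have hx' := hE hx
      rw [← hd] at hx'
      obtain ⟨b, hb, rfl⟩ := hx'
      exact ⟨b, ⟨hb, hx⟩, rfl⟩
  · apply Subset.antisymm
    · rintro _ ⟨b, hb, rfl⟩
      -- If `ran b` were outside `E`, it would be an element of `B` with the same range as `b`. Then
      -- `b` would be an identity, and its domain would lie outside `E` too.
      by_contra hbE
      have h1 : ran b ∈ units H \ E := ⟨ran_mem b, hbE⟩
      have h2 : ran b = b := hinj.2 (h h1) hb.1 (ran_ran b)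
      have h3 : dom b = ran b := by
        have h4 := dom_ran b
        rw [h2] at h4
        rw [h4, h2]
      exact hbE (h3 ▸ hb.2)
    · intro x hx
      have hx' := hE hx
      rw [← hr] at hx'
      obtain ⟨b, hb, rfl⟩ := hx'
      refine ⟨b, ⟨hb, ?_⟩, rfl⟩
      -- The same argument with domain and range exchanged.
      by_contra hbE
      have h1 : dom b ∈ units H \ E := ⟨dom_mem b, hbE⟩
      have h2 : dom b = b := hinj.1 (h h1) hb (dom_dom b)
      have h3 : ran b = dom b := by
        have h4 := ran_dom b
        rw [h2] at h4
        rw [h4, h2]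
      exact hbE (show dom b ∈ E from h3 ▸ hx)

end Extend

/-! ### Open embeddings of groupoids. -/

/-- An injective functor of groupoids that is an open embedding and whose image contains every
arrow that starts in it. -/
structure OpenGroupoidEmbedding (G : Type u) (H : Type v) [AlgGroupoid G] [AlgGroupoid H]
    [TopologicalSpace G] [TopologicalSpace H] where
  toFun : G → H
  isOpenEmbedding : IsOpenEmbedding toFun
  map_dom : ∀ g, toFun (dom g) = dom (toFun g)
  map_ran : ∀ g, toFun (ran g) = ran (toFun g)
  map_comp : ∀ g h p q, toFun (comp g h p) = comp (toFun g) (toFun h) q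
  mem_range : ∀ h, dom h ∈ range toFun → h ∈ range toFun

namespace OpenGroupoidEmbedding

variable {G : Type u} {H : Type v} [AlgGroupoid G] [AlgGroupoid H] [TopologicalSpace G]
  [TopologicalSpace H] (i : OpenGroupoidEmbedding G H)

theorem injective : Function.Injective i.toFun := i.isOpenEmbedding.injective

theorem image_units_subset {E : Set G} (hE : E ⊆ units G) : i.toFun '' E ⊆ units H := by
  rintro _ ⟨e, he, rfl⟩
  change dom _ = _
  rw [← i.map_dom, show dom e = e from hE he]

/-- The nontrivial inclusion uses injectivity: elements of `G` whose images are composable in `H`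
are already composable. -/
theorem image_setMul (A B : Set G) :
    i.toFun '' setMul A B = setMul (i.toFun '' A) (i.toFun '' B) := by
  ext x
  constructor
  · rintro ⟨_, ⟨a, ha, b, hb, p, rfl⟩, rfl⟩
    have q : dom (i.toFun a) = ran (i.toFun b) := by rw [← i.map_dom, ← i.map_ran, p]
    exact ⟨_, ⟨a, ha, rfl⟩, _, ⟨b, hb, rfl⟩, q, (i.map_comp a b p q).symm⟩
  · rintro ⟨_, ⟨a, ha, rfl⟩, _, ⟨b, hb, rfl⟩, q, rfl⟩
    have p : dom a = ran b := i.injective (by rw [i.map_dom, i.map_ran, q])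
    exact ⟨_, ⟨a, ha, b, hb, p, rfl⟩, i.map_comp a b p q⟩

/-- Preservation of inverses is not a field of the structure. It follows from uniqueness of
inverses, because the images of `g` and `inv g` multiply to an identity. -/
theorem map_inv (g : G) : i.toFun (inv g) = inv (i.toFun g) := by
  have p : dom (inv (i.toFun g)) = ran (inv (i.toFun (inv g))) := by
    rw [dom_inv, ran_inv, ← i.map_ran, ← i.map_dom, dom_inv]
  symm
  have q : dom (i.toFun g) = ran (i.toFun (inv g)) := by
    rw [← i.map_ran, ← i.map_dom, ran_inv]
  have h1 := i.map_comp g (inv g) (ran_inv g).symm q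
  rw [comp_inv] at h1
  apply eq_of_inv_comp (a := inv (i.toFun g)) (by rw [inv_inv_g, q])
  rw [comp_congr (inv_inv_g _) rfl _ q, ← h1, i.map_ran]
  exact ran_mem _

theorem image_setInv (A : Set G) : i.toFun '' setInv A = setInv (i.toFun '' A) := by
  simp only [setInv, image_image, i.map_inv]

end OpenGroupoidEmbedding

/-! ### Local units of `KB(G)` as sets. -/

section LocalUnits

variable {G : Type u} [AlgGroupoid G] [TopologicalSpace G] [BooleanGroupoid G]

/-- `sdiff'` is picked by choice, but its defining properties determine it: products of idempotents
are intersections and joins are unions. -/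
theorem KB.sdiff_carrier {e f : Idem (KB G)} (h : e.1 ≤ f.1) :
    (sdiff' f e).carrier = f.1.carrier \ e.1.carrier := by
  have h1 := KB.lub_carrier (compat_of_lub (sdiff_lub h)) (sdiff_lub h)
  have h2 := congrArg KB.carrier (mul_sdiff f e)
  rw [KB.mul_carrier, setMul_of_units (KB.idem_iff.1 e.2) (KB.idem_iff.1 (sdiff_idem f e)),
    KB.zero_carrier] at h2
  rw [h1, union_sdiff_left]
  exact (sdiff_eq_left.2 (disjoint_iff_inter_eq_empty.2 (inter_comm _ _ ▸ h2))).symm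

theorem KB.phi_carrier {e f : Idem (KB G)} (h : e.1 ≤ f.1) (a : LocalUnits e) :
    (phi h a).val.val.carrier = a.val.val.carrier ∪ (f.1.carrier \ e.1.carrier) := by
  rw [phi_val, KB.lub_carrier (compat_sdiff f a.val) (join_lub (compat_sdiff f a.val)),
    KB.sdiff_carrier h]

/-- The inverse in the group `G_e` satisfies the two equations that characterise the inverse in the
ambient semigroup. -/
theorem localUnits_inv {S : Type u} [BooleanInverseSemigroup S] {e : Idem S} (a : LocalUnits e) :
    (a⁻¹).val.val = a.val.val⁻¹ := by
  have h1 := congrArg LocalMonoid.val a.mul_inv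
  have h2 := congrArg LocalMonoid.val a.inv_mul
  rw [LocalMonoid.mul_val, LocalMonoid.one_val] at h1 h2
  apply inv_unique
  · rw [h1, a.val.left]
  · rw [h2, (a⁻¹).val.left]

theorem localUnits_mul_inv {S : Type u} [BooleanInverseSemigroup S] {e : Idem S}
    (a : LocalUnits e) : a.val.val * a.val.val⁻¹ = e.1 := by
  rw [← localUnits_inv]
  exact congrArg LocalMonoid.val a.mul_inv

theorem localUnits_inv_mul {S : Type u} [BooleanInverseSemigroup S] {e : Idem S}
    (a : LocalUnits e) : a.val.val⁻¹ * a.val.val = e.1 := by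
  rw [← localUnits_inv]
  exact congrArg LocalMonoid.val a.inv_mul

/-- An element `a` of an inverse semigroup with `a⁻¹ a = a a⁻¹ = e` is a unit of `eSe`. -/
def localUnitsMk {S : Type u} [BooleanInverseSemigroup S] {e : Idem S} (a : S)
    (h1 : a⁻¹ * a = e.1) (h2 : a * a⁻¹ = e.1) : LocalUnits e where
  val := ⟨a, by rw [← h2, InverseSemigroup.mul_inv_mul], by
    rw [← h1, ← mul_assoc, InverseSemigroup.mul_inv_mul]⟩
  inv := ⟨a⁻¹, by rw [← h1, InverseSemigroup.inv_mul_inv], by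
    rw [← h2, ← mul_assoc, InverseSemigroup.inv_mul_inv]⟩
  val_inv := LocalMonoid.ext h2
  inv_val := LocalMonoid.ext h1

end LocalUnits

/-! ### The extension homomorphism to the topological full group. -/

namespace OpenGroupoidEmbedding

variable {G : Type u} {H : Type v} [AlgGroupoid G] [AlgGroupoid H] [TopologicalSpace G]
  [TopologicalSpace H] [BooleanGroupoid G] (i : OpenGroupoidEmbedding G H)

theorem idem_image_subset (e : Idem (KB G)) : i.toFun '' e.1.carrier ⊆ units H :=
  i.image_units_subset (KB.idem_iff.1 e.2)

theorem image_mul_idem {e : Idem (KB G)} (a : LocalMonoid e) :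
    setMul (i.toFun '' a.val.carrier) (i.toFun '' e.1.carrier) = i.toFun '' a.val.carrier := by
  rw [← i.image_setMul]
  exact congrArg (fun x : KB G => i.toFun '' x.carrier) a.right

theorem image_idem_mul {e : Idem (KB G)} (a : LocalMonoid e) :
    setMul (i.toFun '' e.1.carrier) (i.toFun '' a.val.carrier) = i.toFun '' a.val.carrier := by
  rw [← i.image_setMul]
  exact congrArg (fun x : KB G => i.toFun '' x.carrier) a.left

variable [BooleanGroupoid H] [CompactSpace (units H)]

/-- The bisection of `H` obtained from a unit of a local monoid of `KB(G)` by adding the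
identities outside its support. -/
def extend (x : Cliff (KB G)) : TopFullGroup H where
  carrier := extendUnits (i.toFun '' x.idem.1.carrier) (i.toFun '' x.unit.val.val.carrier)
  -- The added identities form an open set because the image of `E` is compact in the Hausdorff
  -- space `H_o`.
  isOpen := (i.isOpenEmbedding.isOpenMap _ x.unit.val.val.isOpen).union
    (diff_isOpen isOpen_units Subset.rfl
      (x.idem.1.isCompact.image i.isOpenEmbedding.continuous) (i.idem_image_subset _))
  -- They form a compact set because an open set is removed from the compact space `H_o`.
  isCompact := (x.unit.val.val.isCompact.image i.isOpenEmbedding.continuous).union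
    ((isCompact_iff_compactSpace.2 inferInstance : IsCompact (units H)).diff
      (i.isOpenEmbedding.isOpenMap _ x.idem.1.isOpen))
  isBisection := by
    apply extendUnits_isBisection (i.idem_image_subset _) (i.image_mul_idem _)
      (i.image_idem_mul _)
    · rw [← i.image_setInv, ← i.image_setMul]
      exact congrArg (fun x : KB G => i.toFun '' x.carrier) (localUnits_inv_mul x.unit)
    · rw [← i.image_setInv, ← i.image_setMul]
      exact congrArg (fun x : KB G => i.toFun '' x.carrier) (localUnits_mul_inv x.unit)

theorem extend_phi (x : Cliff (KB G)) {g : Idem (KB G)} (h : x.idem.1 ≤ g.1) :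
    i.extend ⟨g, phi h x.unit⟩ = i.extend x := by
  apply TopFullGroup.ext
  change extendUnits (i.toFun '' g.1.carrier) (i.toFun '' (phi h x.unit).val.val.carrier) = _
  rw [KB.phi_carrier, image_union, image_sdiff i.injective]
  exact extendUnits_trans (i.idem_image_subset _) (image_mono (KB.le_iff.1 h))

/-- Both factors are first moved to the group over the join of their idempotents, which leaves their
extensions unchanged. Then they have a common support and `extendUnits_mul` applies. -/
theorem extend_mul (x y : Cliff (KB G)) : i.extend (x * y) = i.extend x * i.extend y := by
  rw [← i.extend_phi x (le_sup_l x.idem y.idem), ← i.extend_phi y (le_sup_r x.idem y.idem),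
    Cliff.mul_def]
  apply TopFullGroup.ext
  refine Eq.trans ?_ (extendUnits_mul (i.idem_image_subset _) (i.image_mul_idem _)
    (i.image_idem_mul _)).symm
  rw [← i.image_setMul]
  rfl

/-- Over the join of the two idempotents, both extensions add the same identities, so the original
parts can be recovered and compared. -/
theorem phi_eq_of_extend_eq {x y : Cliff (KB G)} (h : i.extend x = i.extend y) :
    phi (le_sup_l x.idem y.idem) x.unit = phi (le_sup_r x.idem y.idem) y.unit := by
  rw [← i.extend_phi x (le_sup_l x.idem y.idem),
    ← i.extend_phi y (le_sup_r x.idem y.idem)] at h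
  have h' := congrArg TopFullGroup.carrier h
  apply Units.ext
  apply LocalMonoid.ext
  apply KB.ext
  apply i.injective.image_injective
  exact (subset_of_extendUnits_eq (i.image_mul_idem _) (i.idem_image_subset _) h').antisymm
    (subset_of_extendUnits_eq (i.image_mul_idem _) (i.idem_image_subset _) h'.symm)

/-- The preimage of `B` is its restriction to arrows starting in `E`; the rest of `B` consists of
the identities outside `E`. -/
theorem extend_surjective (hi : ∀ B : TopFullGroup H, ∃ E : Set G, IsOpen E ∧ IsCompact E ∧
    E ⊆ units G ∧ units H \ i.toFun '' E ⊆ B.carrier) : Function.Surjective i.extend := by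
  intro B
  obtain ⟨E, hEo, hEc, hEu, hEB⟩ := hi B
  have hE' := i.image_units_subset hEu
  obtain ⟨hB1, hB2, hB3⟩ := B.isBisection.extendUnits_inter hEB hE'
  set A : Set H := B.carrier ∩ dom ⁻¹' (i.toFun '' E)
  have hAo : IsOpen A :=
    B.isOpen.inter ((i.isOpenEmbedding.isOpenMap _ hEo).preimage continuous_dom)
  have hAc : IsCompact A := by
    -- `H` need not be Hausdorff, so closedness of the preimage of `E` under `dom` is not at hand.
    -- Instead `A` is what remains of the compact set `B` after removing an open set of identities.
    have h1 : A = B.carrier \ (units H \ i.toFun '' E) := by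
      apply Subset.antisymm
      · rintro a ⟨ha1, ha2⟩
        refine ⟨ha1, fun h => h.2 ?_⟩
        rwa [mem_preimage, show dom a = a from h.1] at ha2
      · rintro a ⟨ha1, ha2⟩
        rw [← hB1] at ha1
        exact ha1.resolve_right ha2
    rw [h1]
    exact B.isCompact.diff (diff_isOpen isOpen_units Subset.rfl
      (hEc.image i.isOpenEmbedding.continuous) hE')
  -- Arrows of `A` start in the image of `G`, hence lie in it; thus `A` can be pulled back to `G`
  -- without loss.
  have hAr : A ⊆ range i.toFun := by
    rintro a ⟨-, g, -, hg⟩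
    exact i.mem_range a ⟨g, hg⟩
  have hAi : i.toFun '' (i.toFun ⁻¹' A) = A := image_preimage_eq_of_subset hAr
  have hAl : IsLocalBisection A := by
    have := isLocalBisection_iff.1 B.isBisection.isLocalBisection
    exact isLocalBisection_iff.2 ⟨this.1.mono inter_subset_left, this.2.mono inter_subset_left⟩
  have hAl' : IsLocalBisection (i.toFun ⁻¹' A) := by
    rw [isLocalBisection_iff] at hAl ⊢
    refine ⟨fun a ha b hb h => i.injective (hAl.1 ha hb ?_),
      fun a ha b hb h => i.injective (hAl.2 ha hb ?_)⟩
    · rw [← i.map_dom, ← i.map_dom, h]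
    · rw [← i.map_ran, ← i.map_ran, h]
  let a : KB G := ⟨i.toFun ⁻¹' A, hAo.preimage i.isOpenEmbedding.continuous, by
    rwa [i.isOpenEmbedding.isInducing.isCompact_iff, hAi], hAl'⟩
  let e : Idem (KB G) := ⟨⟨E, hEo, hEc, isLocalBisection_of_subset_units hEu⟩,
    KB.idem_iff.2 hEu⟩
  -- The sets of domains and of ranges of `A` are both the image of `E`, which makes the pullback of
  -- `A` a unit of the local monoid at `E`.
  have h1 : a⁻¹ * a = e.1 := by
    apply KB.ext
    apply i.injective.image_injective
    rw [KB.mul_carrier, i.image_setMul, KB.inv_carrier, i.image_setInv]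
    change setMul (setInv (i.toFun '' (i.toFun ⁻¹' A))) (i.toFun '' (i.toFun ⁻¹' A)) = _
    rw [hAi, setInv_mul_self_dom hAl, hB2]
  have h2 : a * a⁻¹ = e.1 := by
    apply KB.ext
    apply i.injective.image_injective
    rw [KB.mul_carrier, i.image_setMul, KB.inv_carrier, i.image_setInv]
    change setMul (i.toFun '' (i.toFun ⁻¹' A)) (setInv (i.toFun '' (i.toFun ⁻¹' A))) = _
    rw [hAi, setMul_inv_self_ran hAl, hB3]
  refine ⟨⟨e, localUnitsMk a h1 h2⟩, TopFullGroup.ext ?_⟩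
  change extendUnits (i.toFun '' E) (i.toFun '' (i.toFun ⁻¹' A)) = _
  rw [hAi, hB1]

theorem nonempty_mulEquiv (hi : ∀ B : TopFullGroup H, ∃ E : Set G, IsOpen E ∧ IsCompact E ∧
    E ⊆ units G ∧ units H \ i.toFun '' E ⊆ B.carrier) :
    Nonempty (UnitGroup (KB G) ≃* TopFullGroup H) :=
  UnitGroup.nonempty_mulEquiv ⟨i.extend, i.extend_mul⟩ (i.extend_surjective hi)
    fun _ _ h => ⟨_, _, _, i.phi_eq_of_extend_eq h⟩

end OpenGroupoidEmbedding

/-! ### The embeddings of `G` and of `G^∞` into `G^∞`. -/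

section Instances

/-- Every identity is the domain of an element of a bisection, and no arrow other than `∞` has
domain `∞`. -/
theorem Ginf.infty_mem_of_isBisection {G : Type u} [AlgGroupoid G] {B : Set (Ginf G)} (hB : IsBisection B) :
    (Ginf.infty : Ginf G) ∈ B := by
  have h : (Ginf.infty : Ginf G) ∈ dom '' B := by
    rw [← setInv_mul_self_dom hB.isLocalBisection, hB.1]
    rfl
  obtain ⟨b, hb, hb'⟩ := h
  cases b with
  | of g => exact nomatch hb'
  | infty => exact hb

variable {G : Type u} [AlgGroupoid G] [TopologicalSpace G]

/-- The identity of `G` as an open embedding of groupoids. -/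
def OpenGroupoidEmbedding.refl (G : Type u) [AlgGroupoid G] [TopologicalSpace G] :
    OpenGroupoidEmbedding G G where
  toFun := id
  isOpenEmbedding := .id
  map_dom _ := rfl
  map_ran _ := rfl
  map_comp _ _ _ _ := rfl
  mem_range h _ := ⟨h, rfl⟩

/-- The open embedding of `G` into `G^∞`. -/
def Ginf.embedding (G : Type u) [AlgGroupoid G] [TopologicalSpace G] [BooleanGroupoid G] :
    OpenGroupoidEmbedding G (Ginf G) where
  toFun := Ginf.of
  isOpenEmbedding := Ginf.isOpenEmbedding_of
  map_dom _ := rfl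
  map_ran _ := rfl
  map_comp _ _ _ _ := rfl
  mem_range h hh := by
    cases h with
    | of g => exact ⟨g, rfl⟩
    | infty =>
      obtain ⟨g, hg⟩ := hh
      exact nomatch hg

/-- Each point has a compact-open neighbourhood, and finitely many of them cover `K`. -/
theorem exists_compactOpen_superset [BooleanGroupoid G] {K : Set (units G)} (hK : IsCompact K) :
    ∃ E : Set (units G), IsOpen E ∧ IsCompact E ∧ K ⊆ E := by
  refine hK.induction_on (p := fun s => ∃ E : Set (units G), IsOpen E ∧ IsCompact E ∧ s ⊆ E)
    ⟨∅, isOpen_empty, isCompact_empty, Subset.rfl⟩ ?_ ?_ ?_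
  · rintro s t hst ⟨E, h1, h2, h3⟩
    exact ⟨E, h1, h2, hst.trans h3⟩
  · rintro s t ⟨E, h1, h2, h3⟩ ⟨F, k1, k2, k3⟩
    exact ⟨E ∪ F, h1.union k1, h2.union k2, union_subset_union h3 k3⟩
  · intro x _
    obtain ⟨E, h1, h2, h3, -⟩ := Ginf.exists_compactOpen x isOpen_univ (mem_univ x)
    exact ⟨E, mem_nhdsWithin_of_mem_nhds (h1.mem_nhds h3), E, h1, h2, Subset.rfl⟩

/-- This is the surjectivity condition for `G^∞`: the trace of `B` on the one-point compactification
of `G_o` is a neighbourhood of `∞`. -/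
theorem Ginf.exists_diff_subset [BooleanGroupoid G] (B : TopFullGroup (Ginf G)) :
    ∃ E : Set G, IsOpen E ∧ IsCompact E ∧ E ⊆ units G ∧
      units (Ginf G) \ (Ginf.embedding G).toFun '' E ⊆ B.carrier := by
  have hinf : OnePoint.infty ∈ (Ginf.incl : OnePoint (units G) → Ginf G) ⁻¹' B.carrier :=
    Ginf.infty_mem_of_isBisection B.isBisection
  -- The second component is compactness of the set of those identities of `G` that are missing from
  -- `B`.
  have hK := ((OnePoint.isOpen_iff_of_mem hinf).1
    (B.isOpen.preimage Ginf.continuous_incl)).2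
  obtain ⟨E, hEo, hEc, hKE⟩ := exists_compactOpen_superset hK
  refine ⟨Subtype.val '' E, isOpen_units.isOpenMap_subtype_val _ hEo,
    hEc.image continuous_subtype_val, Subtype.coe_image_subset _ _, ?_⟩
  rintro x ⟨hx, hxE⟩
  rw [← Ginf.range_incl] at hx
  obtain ⟨y, rfl⟩ := hx
  induction y with
  | infty => exact hinf
  | coe y =>
    by_contra hy
    exact hxE ⟨y.1, ⟨y, hKE hy, rfl⟩, rfl⟩

end Instances

end BISG

theorem mainTheorem7 (G : Type*) [BISG.AlgGroupoid G] [TopologicalSpace G]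
    [BISG.BooleanGroupoid G] :
    Nonempty (BISG.UnitGroup (BISG.KB G) ≃* BISG.TopFullGroup (BISG.Ginf G)) ∧
    Nonempty (BISG.UnitGroup (BISG.KB (BISG.Ginf G)) ≃* BISG.TopFullGroup (BISG.Ginf G)) :=
  ⟨(BISG.Ginf.embedding G).nonempty_mulEquiv BISG.Ginf.exists_diff_subset,
    (BISG.OpenGroupoidEmbedding.refl (BISG.Ginf G)).nonempty_mulEquiv fun _ =>
      -- With `E` the entire compact identity space, no identities remain outside it and the
      -- condition on `B` is vacuous.
      ⟨BISG.units (BISG.Ginf G), BISG.isOpen_units, isCompact_iff_compactSpace.2 inferInstance,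
        subset_rfl, by
          rw [show (BISG.OpenGroupoidEmbedding.refl (BISG.Ginf G)).toFun = id from rfl,
            Set.image_id, sdiff_self]
          exact Set.empty_subset _⟩⟩
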